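/- Let $P$ be an infinite set of primes. Then there is a faithful self-similar action of the group $\overline G=\prod_{p\in P} C_p\times C_p$ (where $C_p$ is the cyclic group of order $p$) over an alphabet $X$ with at least two letters such that the following holds. Let $S$ be the inverse semigroup of this action, consisting of $0$ and the elements $ugv^*$ with $u,v\in X^*$ and $g\in\overline G$, multiplied by the rules $gx=g(x)\,g|_x$, $x^*g=g|_{g^{-1}(x)}\,(g^{-1}(x))^*$, $x^*x=1$ and $x^*y=0$ for letters $x\ne y$. Let $\mathcal G=\mathcal G(S)$ be its (contracted) universal groupoid, that is, the groupoid of germs of the action of $S$ on the space of characters (non-zero, zero-preserving semilattice homomorphisms to $\{0,1\}$, with the topology of pointwise convergence) of the semilattice $E(S)$ of idempotents. Then: 1. $\mathcal G$ is an ample groupoid (étale, with a locally compact Hausdorff unit space that has a basis of compact open sets; $\mathcal G$ itself is not required to be Hausdorff); 2. $\mathcal G$ is minimal (there is no proper non-empty open invariant subset of the unit space) and effective (the interior of the isotropy subgroupoid is the unit space); 3. for every field $K$, the Steinberg algebra $K\mathcal G$ (the $K$-span of the characteristic functions of the compact local bisections of $\mathcal G$, under convolution) is simple if and only if $\operatorname{char}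 K\notin P$; 4. every isotropy group of $\mathcal G$ is uncountable; hence 5. $\mathcal G$ is not topologically principal (the set of objects with trivial isotropy group is not dense in the unit space). -/

import Mathlib

namespace AmpleGpd

universe u v w

/-! Inverse semigroups with zero. -/

/-- A semigroup with zero in which every `s` has a unique `s⁻¹` such that
`s * s⁻¹ * s = s` and `s⁻¹ * s * s⁻¹ = s⁻¹`. -/
class InverseSemigroupWithZero (S : Type u) extends SemigroupWithZero S, Inv S where
  mul_inv_mul : ∀ s : S, s * s⁻¹ * s = s
  inv_mul_inv : ∀ s : S, s⁻¹ * s * s⁻¹ = s⁻¹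
  inv_unique : ∀ s t : S, s * t * s = s → t * s * t = t → t = s⁻¹

section InverseSemigroup

variable {S : Type u} [InverseSemigroupWithZero S]

open InverseSemigroupWithZero

theorem idem_inv {e : S} (he : e * e = e) : e⁻¹ = e :=
  (InverseSemigroupWithZero.inv_unique e e (by rw [he, he]) (by rw [he, he])).symm

theorem inv_inv' (s : S) : s⁻¹⁻¹ = s :=
  (InverseSemigroupWithZero.inv_unique s⁻¹ s (inv_mul_inv s) (mul_inv_mul s)).symm

theorem idem_mul_idem {e f : S} (he : e * e = e) (hf : f * f = f) :
    (e * f) * (e * f) = e * f := by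
  have h1 := mul_inv_mul (e * f)
  have h2 := inv_mul_inv (e * f)
  generalize hx : (e * f)⁻¹ = x at h1 h2
  have hfx : f * x * e = x := by
    rw [← hx]
    apply InverseSemigroupWithZero.inv_unique
    · rw [hx]
      calc e * f * (f * x * e) * (e * f) = e * (f * f) * x * (e * e) * f := by
            simp only [mul_assoc]
        _ = e * f * x * (e * f) := by rw [he, hf]; simp only [mul_assoc]
        _ = e * f := h1
    · rw [hx]
      calc f * x * e * (e * f) * (f * x * e)
          = f * (x * ((e * e) * (f * f)) * x) * e := by simp only [mul_assoc]
        _ = f * x * e := by rw [he, hf, h2]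
  have hxx : x * x = x := by
    calc x * x = (f * x * e) * (f * x * e) := by rw [hfx]
      _ = f * (x * (e * f) * x) * e := by simp only [mul_assoc]
      _ = x := by rw [h2, hfx]
  have : e * f = x := by
    have h := idem_inv hxx
    rw [← hx, inv_inv', hx] at h
    exact h
  rw [this, hxx]

theorem idem_comm {e f : S} (he : e * e = e) (hf : f * f = f) : e * f = f * e := by
  have h1 := idem_mul_idem he hf
  have h2 := idem_mul_idem hf he
  have h3 : f * e = (e * f)⁻¹ := by
    apply InverseSemigroupWithZero.inv_unique
    · calc e * f * (f * e) * (e * f) = e * (f * f) * (e * e) * f := by simp only [mul_assoc]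
        _ = (e * f) * (e * f) := by rw [he, hf]; simp only [mul_assoc]
        _ = e * f := h1
    · calc f * e * (e * f) * (f * e) = f * (e * e) * (f * f) * e := by simp only [mul_assoc]
        _ = (f * e) * (f * e) := by rw [he, hf]; simp only [mul_assoc]
        _ = f * e := h2
  rw [h3, idem_inv h1]

theorem inv_mul_idem (s : S) : (s⁻¹ * s) * (s⁻¹ * s) = s⁻¹ * s := by
  rw [← mul_assoc, inv_mul_inv]

theorem mul_inv_idem (s : S) : (s * s⁻¹) * (s * s⁻¹) = s * s⁻¹ := by
  rw [← mul_assoc, mul_inv_mul]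

theorem mul_inv_rev' (s t : S) : (s * t)⁻¹ = t⁻¹ * s⁻¹ := by
  symm
  have hc := idem_comm (inv_mul_idem s) (mul_inv_idem t)
  apply InverseSemigroupWithZero.inv_unique
  · calc s * t * (t⁻¹ * s⁻¹) * (s * t) = s * ((t * t⁻¹) * (s⁻¹ * s)) * t := by
          simp only [mul_assoc]
      _ = (s * s⁻¹ * s) * (t * t⁻¹ * t) := by rw [← hc]; simp only [mul_assoc]
      _ = s * t := by rw [mul_inv_mul, mul_inv_mul]
  · calc t⁻¹ * s⁻¹ * (s * t) * (t⁻¹ * s⁻¹) = t⁻¹ * ((s⁻¹ * s) * (t * t⁻¹)) * s⁻¹ := by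
          simp only [mul_assoc]
      _ = (t⁻¹ * t * t⁻¹) * (s⁻¹ * s * s⁻¹) := by rw [hc]; simp only [mul_assoc]
      _ = t⁻¹ * s⁻¹ := by rw [inv_mul_inv, inv_mul_inv]

theorem conj_idem (s : S) {e : S} (he : e * e = e) :
    (s⁻¹ * e * s) * (s⁻¹ * e * s) = s⁻¹ * e * s := by
  have hc := idem_comm he (mul_inv_idem s)
  calc (s⁻¹ * e * s) * (s⁻¹ * e * s) = s⁻¹ * (e * (s * s⁻¹)) * (e * s) := by
        simp only [mul_assoc]
    _ = (s⁻¹ * s * s⁻¹) * (e * e) * s := by rw [hc]; simp only [mul_assoc]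
    _ = s⁻¹ * e * s := by rw [he, inv_mul_inv]

/-- The natural partial order: `s ≤ t` iff `s = t s* s`. -/
def NatLE (s t : S) : Prop := s = t * (s⁻¹ * s)

theorem natLE_of_idem {s e : S} (he : e * e = e) : NatLE (s * e) s := by
  have hc := idem_comm he (inv_mul_idem s)
  have : (s * e)⁻¹ * (s * e) = (s⁻¹ * s) * e := by
    rw [mul_inv_rev', idem_inv he]
    calc e * s⁻¹ * (s * e) = e * (s⁻¹ * s) * e := by simp only [mul_assoc]
      _ = (s⁻¹ * s) * e := by rw [hc, mul_assoc, he]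
  unfold NatLE
  rw [this, ← mul_assoc, ← mul_assoc, mul_inv_mul]

theorem natLE_iff {s t : S} : NatLE s t ↔ ∃ e : S, e * e = e ∧ s = t * e :=
  ⟨fun h => ⟨_, inv_mul_idem s, h⟩, fun ⟨_, he, h⟩ => h ▸ natLE_of_idem he⟩

variable (S) in
/-- The semilattice of idempotents `E(S)`. -/
abbrev Idem : Type u := {e : S // e * e = e}

instance : Mul (Idem S) := ⟨fun e f => ⟨e.1 * f.1, idem_mul_idem e.2 f.2⟩⟩

instance : Zero (Idem S) := ⟨⟨0, mul_zero 0⟩⟩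

/-- The idempotent `s* s`. -/
def dom (s : S) : Idem S := ⟨s⁻¹ * s, inv_mul_idem s⟩

/-- The idempotent `s* e s`. -/
def conj (s : S) (e : Idem S) : Idem S := ⟨s⁻¹ * e.1 * s, conj_idem s e.2⟩

variable (S) in
/-- The spectrum of `E(S)`: the non-zero, zero-preserving semilattice homomorphisms
`E(S) → {0, 1}`. -/
structure Spectrum : Type u where
  toFun : Idem S → Bool
  map_zero : toFun 0 = false
  map_mul : ∀ e f, toFun (e * f) = (toFun e && toFun f)
  exists_one : ∃ e, toFun e = true

instance : CoeFun (Spectrum S) (fun _ => Idem S → Bool) := ⟨Spectrum.toFun⟩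

/-- The topology of pointwise convergence. -/
instance : TopologicalSpace (Spectrum S) :=
  TopologicalSpace.induced Spectrum.toFun inferInstance

/-- The compact open set `D(e)`. -/
def D (e : Idem S) : Set (Spectrum S) := {θ | θ e = true}

theorem spec_of_mul_eq (θ : Spectrum S) {e f : Idem S} (h : e * f = e) (he : θ e = true) :
    θ f = true := by
  have := θ.map_mul e f
  rw [h, he] at this
  simpa using this.symm

/-- The map `β_s : D(s* s) → D(s s*)`, `β_s(θ)(e) = θ(s* e s)`. -/
def beta (s : S) (θ : Spectrum S) (hθ : θ (dom s) = true) : Spectrum S where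
  toFun e := θ (conj s e)
  map_zero := by
    have : conj s (0 : Idem S) = 0 := Subtype.ext (by
      change s⁻¹ * 0 * s = 0
      rw [mul_zero, zero_mul])
    rw [this]
    exact θ.map_zero
  map_mul e f := by
    rw [← θ.map_mul]
    congr 1
    apply Subtype.ext
    change s⁻¹ * (e.1 * f.1) * s = (s⁻¹ * e.1 * s) * (s⁻¹ * f.1 * s)
    symm
    calc (s⁻¹ * e.1 * s) * (s⁻¹ * f.1 * s) = s⁻¹ * (e.1 * (s * s⁻¹)) * (f.1 * s) := by
          simp only [mul_assoc]
      _ = (s⁻¹ * s * s⁻¹) * (e.1 * f.1) * s := by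
          rw [idem_comm e.2 (mul_inv_idem s)]; simp only [mul_assoc]
      _ = s⁻¹ * (e.1 * f.1) * s := by rw [inv_mul_inv]
  exists_one := by
    refine ⟨⟨s * s⁻¹, mul_inv_idem s⟩, ?_⟩
    have : conj s (⟨s * s⁻¹, mul_inv_idem s⟩ : Idem S) = dom s := Subtype.ext (by
      change s⁻¹ * (s * s⁻¹) * s = s⁻¹ * s
      rw [← mul_assoc, inv_mul_inv])
    rw [this]
    exact hθ

theorem beta_apply (s : S) (θ : Spectrum S) (hθ : θ (dom s) = true) (e : Idem S) :
    beta s θ hθ e = θ (conj s e) := rfl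

theorem spectrum_ext {θ η : Spectrum S} (h : ∀ e, θ e = η e) : θ = η := by
  cases θ
  cases η
  congr 1
  exact funext h

/-! The groupoid of germs of the action of `S` on the spectrum. -/

variable (S) in
/-- The pairs `(s, θ)` with `θ ∈ D(s* s)`. -/
abbrev PreGerm : Type u := {p : S × Spectrum S // p.2 (dom p.1) = true}

/-- `(s, θ) ∼ (t, η)` iff `θ = η` and there is `u ≤ s, t` with `θ ∈ D(u* u)`. -/
def GermRel (p q : PreGerm S) : Prop :=
  p.1.2 = q.1.2 ∧ ∃ x : S, NatLE x p.1.1 ∧ NatLE x q.1.1 ∧ p.1.2 (dom x) = true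

/-- If `θ ∈ D(e)` and `θ ∈ D(s* s)` then `θ ∈ D((s e)* (s e))`. -/
theorem spec_dom_mul (θ : Spectrum S) {s e : S} (he : e * e = e)
    (hs : θ (dom s) = true) (hθ : θ ⟨e, he⟩ = true) : θ (dom (s * e)) = true := by
  have : dom (s * e) = dom s * ⟨e, he⟩ := Subtype.ext (by
    change (s * e)⁻¹ * (s * e) = (s⁻¹ * s) * e
    have hc := idem_comm he (inv_mul_idem s)
    rw [mul_inv_rev', idem_inv he]
    calc e * s⁻¹ * (s * e) = e * (s⁻¹ * s) * e := by simp only [mul_assoc]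
      _ = (s⁻¹ * s) * e := by rw [hc, mul_assoc, he])
  rw [this, θ.map_mul, hs, hθ]
  rfl

/-- Two pairs are equivalent iff `s e = t e` for some idempotent `e` with `θ ∈ D(e)`. -/
theorem germRel_iff {p q : PreGerm S} :
    GermRel p q ↔ p.1.2 = q.1.2 ∧
      ∃ e : Idem S, p.1.2 e = true ∧ p.1.1 * e.1 = q.1.1 * e.1 := by
  constructor
  · rintro ⟨h, x, h1, h2, h3⟩
    exact ⟨h, dom x, h3, by
      change p.1.1 * (x⁻¹ * x) = q.1.1 * (x⁻¹ * x)
      rw [← h1, ← h2]⟩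
  · rintro ⟨h, e, h1, h2⟩
    exact ⟨h, p.1.1 * e.1, natLE_of_idem e.2, h2 ▸ natLE_of_idem e.2,
      spec_dom_mul _ e.2 p.2 h1⟩

theorem germRel_equivalence : Equivalence (GermRel (S := S)) where
  refl p := germRel_iff.2 ⟨rfl, dom p.1.1, p.2, rfl⟩
  symm {p q} h := by
    obtain ⟨h1, e, h2, h3⟩ := germRel_iff.1 h
    exact germRel_iff.2 ⟨h1.symm, e, h1 ▸ h2, h3.symm⟩
  trans {p q r} h h' := by
    obtain ⟨h1, e, h2, h3⟩ := germRel_iff.1 h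
    obtain ⟨h1', e', h2', h3'⟩ := germRel_iff.1 h'
    refine germRel_iff.2 ⟨h1.trans h1', e * e', ?_, ?_⟩
    · rw [p.1.2.map_mul, h2, h1, h2']
      rfl
    · change p.1.1 * (e.1 * e'.1) = r.1.1 * (e.1 * e'.1)
      rw [← mul_assoc, h3, idem_comm e.2 e'.2, ← mul_assoc, ← h3', mul_assoc, mul_assoc,
        idem_comm e.2 e'.2]

variable (S) in
/-- The set of germs, that is, of arrows of the universal groupoid. -/
def Germ : Type u := Quotient (⟨GermRel, germRel_equivalence⟩ : Setoid (PreGerm S))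

/-- The germ `[s, θ]`. -/
def germ (s : S) (θ : Spectrum S) (h : θ (dom s) = true) : Germ S :=
  Quotient.mk _ ⟨(s, θ), h⟩

theorem germ_eq_iff {s t : S} {θ η : Spectrum S} {hs : θ (dom s) = true}
    {ht : η (dom t) = true} :
    germ s θ hs = germ t η ht ↔ θ = η ∧ ∃ e : Idem S, θ e = true ∧ s * e.1 = t * e.1 :=
  Quotient.eq.trans germRel_iff

/-- `[s, θ]` does not depend on the representative `s`. -/
theorem germ_congr {s t : S} {θ η : Spectrum S} (h : θ = η) (hs : θ (dom s) = true)
    (ht : η (dom t) = true) (e : Idem S) (he : θ e = true) (hst : s * e.1 = t * e.1) :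
    germ s θ hs = germ t η ht := germ_eq_iff.2 ⟨h, e, he, hst⟩

theorem spec_dom_conj (θ : Spectrum S) {t : S} (ht : θ (dom t) = true) (e : Idem S) :
    θ (conj t e * dom t) = θ (conj t e) := by
  rw [θ.map_mul, ht, Bool.and_true]

theorem beta_congr {s t : S} {θ : Spectrum S} (hs : θ (dom s) = true)
    (ht : θ (dom t) = true) (e : Idem S) (he : θ e = true) (hst : s * e.1 = t * e.1) :
    beta s θ hs = beta t θ ht := by
  apply spectrum_ext
  intro f
  have key : ∀ x : S, θ (conj x f) = θ (conj (x * e.1) f) := by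
    intro x
    have : conj (x * e.1) f = e * conj x f * e := Subtype.ext (by
      change (x * e.1)⁻¹ * f.1 * (x * e.1) = e.1 * (x⁻¹ * f.1 * x) * e.1
      rw [mul_inv_rev', idem_inv e.2]
      simp only [mul_assoc])
    rw [this, θ.map_mul, θ.map_mul, he, Bool.and_true, Bool.true_and]
  rw [beta_apply, beta_apply, key s, key t, hst]

/-- The domain `d([s, θ]) = θ`. -/
def germDom (g : Germ S) : Spectrum S :=
  Quotient.lift (fun p : PreGerm S => p.1.2) (fun p q (h : GermRel p q) => h.1) g

/-- The range `r([s, θ]) = β_s(θ)`. -/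
def germRan (g : Germ S) : Spectrum S :=
  Quotient.lift (fun p : PreGerm S => beta p.1.1 p.1.2 p.2) (by
    rintro ⟨⟨s, θ⟩, hs⟩ ⟨⟨t, η⟩, ht⟩ h
    obtain ⟨h1, e, h2, h3⟩ := germRel_iff.1 h
    change θ = η at h1
    subst h1
    exact beta_congr hs ht e h2 h3) g

@[simp] theorem germDom_germ (s : S) (θ : Spectrum S) (h : θ (dom s) = true) :
    germDom (germ s θ h) = θ := rfl

@[simp] theorem germRan_germ (s : S) (θ : Spectrum S) (h : θ (dom s) = true) :
    germRan (germ s θ h) = beta s θ h := rfl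

theorem germ_surj (g : Germ S) : ∃ s θ h, g = germ s θ h := by
  induction g using Quotient.ind with
  | _ p => exact ⟨p.1.1, p.1.2, p.2, rfl⟩

/-- A representative of a germ. -/
noncomputable def rep (g : Germ S) : S := (germ_surj g).choose

theorem rep_spec (g : Germ S) :
    ∃ h : germDom g (dom (rep g)) = true, g = germ (rep g) (germDom g) h := by
  obtain ⟨θ, h, hg⟩ := (germ_surj g).choose_spec
  have : germDom g = θ := by rw [hg]; rfl
  subst this
  exact ⟨h, hg⟩

theorem spec_dom_comp {s t : S} {θ : Spectrum S} (ht : θ (dom t) = true)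
    (hs : beta t θ ht (dom s) = true) : θ (dom (s * t)) = true := by
  rw [beta_apply] at hs
  have : conj t (dom s) = dom (s * t) := Subtype.ext (by
    change t⁻¹ * (s⁻¹ * s) * t = (s * t)⁻¹ * (s * t)
    rw [mul_inv_rev']
    simp only [mul_assoc])
  rwa [this] at hs

theorem spec_dom_inv {s : S} {θ : Spectrum S} (hs : θ (dom s) = true) :
    beta s θ hs (dom s⁻¹) = true := by
  rw [beta_apply]
  have : conj s (dom s⁻¹) = dom s := Subtype.ext (by
    change s⁻¹ * (s⁻¹⁻¹ * s⁻¹) * s = s⁻¹ * s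
    rw [inv_inv', ← mul_assoc, inv_mul_inv])
  rwa [this]

theorem rep_comp {g h : Germ S} (hgh : germDom g = germRan h) :
    germDom h (dom (rep g * rep h)) = true := by
  obtain ⟨hg, -⟩ := rep_spec g
  obtain ⟨hh, eh⟩ := rep_spec h
  have e2 : germRan h = beta (rep h) (germDom h) hh := by
    conv_lhs => rw [eh]
    rfl
  rw [hgh, e2] at hg
  exact spec_dom_comp hh hg

/-- The product `[s, β_t(θ)] [t, θ] = [s t, θ]` (see `germMul_germ`). -/
noncomputable def germMul (g h : Germ S) (hgh : germDom g = germRan h) : Germ S :=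
  germ (rep g * rep h) (germDom h) (rep_comp hgh)

theorem germMul_germ {s t : S} {η θ : Spectrum S} (hs : η (dom s) = true)
    (ht : θ (dom t) = true) (h : germDom (germ s η hs) = germRan (germ t θ ht))
    (hst : θ (dom (s * t)) = true) :
    germMul (germ s η hs) (germ t θ ht) h = germ (s * t) θ hst := by
  have h' : η = beta t θ ht := h
  subst h'
  obtain ⟨a1, a2⟩ := rep_spec (germ s (beta t θ ht) hs)
  obtain ⟨b1, b2⟩ := rep_spec (germ t θ ht)
  obtain ⟨-, e, he, hse⟩ := germ_eq_iff.1 a2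
  obtain ⟨-, f, hf, htf⟩ := germ_eq_iff.1 b2
  refine germ_congr rfl _ _ (f * conj t e) ?_ ?_
  · change θ (f * conj t e) = true
    rw [θ.map_mul, hf, Bool.true_and]
    exact he
  · generalize rep (germ s (beta t θ ht) hs) = s' at *
    generalize rep (germ t θ ht) = t' at *
    have hcf : f.1 * (t⁻¹ * e.1 * t) = (t⁻¹ * e.1 * t) * f.1 := idem_comm f.2 (conj t e).2
    have het : t * (t⁻¹ * e.1 * t) = e.1 * t := by
      calc t * (t⁻¹ * e.1 * t) = ((t * t⁻¹) * e.1) * t := by simp only [mul_assoc]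
        _ = e.1 * (t * t⁻¹ * t) := by
          rw [← idem_comm e.2 (mul_inv_idem t)]; simp only [mul_assoc]
        _ = e.1 * t := by rw [mul_inv_mul]
    change s' * t' * (f.1 * (t⁻¹ * e.1 * t)) = s * t * (f.1 * (t⁻¹ * e.1 * t))
    calc s' * t' * (f.1 * (t⁻¹ * e.1 * t)) = s' * (t' * f.1) * (t⁻¹ * e.1 * t) := by
          simp only [mul_assoc]
      _ = s' * (t * f.1) * (t⁻¹ * e.1 * t) := by rw [htf]
      _ = s' * (t * (t⁻¹ * e.1 * t)) * f.1 := by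
          rw [mul_assoc s', mul_assoc t, hcf]; simp only [mul_assoc]
      _ = (s' * e.1) * t * f.1 := by rw [het]; simp only [mul_assoc]
      _ = s * (e.1 * t) * f.1 := by rw [← hse]; simp only [mul_assoc]
      _ = s * (t * (t⁻¹ * e.1 * t)) * f.1 := by rw [het]
      _ = s * t * (f.1 * (t⁻¹ * e.1 * t)) := by rw [hcf]; simp only [mul_assoc]

/-- The inverse `[s, θ]⁻¹ = [s*, β_s(θ)]`. -/
def germInv (g : Germ S) : Germ S :=
  Quotient.lift
    (fun p : PreGerm S => germ p.1.1⁻¹ (beta p.1.1 p.1.2 p.2) (spec_dom_inv p.2)) (by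
    rintro ⟨⟨s, θ⟩, hs⟩ ⟨⟨t, η⟩, ht⟩ h
    obtain ⟨h1, e, h2, h3⟩ := germRel_iff.1 h
    change θ = η at h1
    subst h1
    change s * e.1 = t * e.1 at h3
    have hidem : (s * e.1 * s⁻¹) * (s * e.1 * s⁻¹) = s * e.1 * s⁻¹ := by
      have := conj_idem s⁻¹ e.2
      rwa [inv_inv'] at this
    refine germ_congr (beta_congr hs ht e h2 h3) _ _ ⟨s * e.1 * s⁻¹, hidem⟩ ?_ ?_
    · change θ (conj s ⟨s * e.1 * s⁻¹, hidem⟩) = true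
      have : conj s ⟨s * e.1 * s⁻¹, hidem⟩ = dom s * e * dom s := Subtype.ext (by
        change s⁻¹ * (s * e.1 * s⁻¹) * s = (s⁻¹ * s) * e.1 * (s⁻¹ * s)
        simp only [mul_assoc])
      have h2' : θ e = true := h2
      have hs' : θ (dom s) = true := hs
      rw [this, θ.map_mul, θ.map_mul, h2', hs']
      rfl
    · change s⁻¹ * (s * e.1 * s⁻¹) = t⁻¹ * (s * e.1 * s⁻¹)
      have hse : e.1 * s⁻¹ = e.1 * t⁻¹ := by
        have := congrArg (fun x => x⁻¹) h3
        simpa only [mul_inv_rev', idem_inv e.2] using this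
      have aux : ∀ x : S, x⁻¹ * (x * e.1 * x⁻¹) = e.1 * x⁻¹ := by
        intro x
        calc x⁻¹ * (x * e.1 * x⁻¹) = (x⁻¹ * x) * e.1 * x⁻¹ := by simp only [mul_assoc]
          _ = e.1 * (x⁻¹ * x * x⁻¹) := by
            rw [← idem_comm e.2 (inv_mul_idem x)]; simp only [mul_assoc]
          _ = e.1 * x⁻¹ := by rw [inv_mul_inv]
      have h4 : s * e.1 * s⁻¹ = t * e.1 * t⁻¹ := by
        rw [mul_assoc, hse, ← mul_assoc, h3]
      rw [aux s, h4, aux t, hse]) g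

theorem germInv_germ (s : S) (θ : Spectrum S) (h : θ (dom s) = true) :
    germInv (germ s θ h) = germ s⁻¹ (beta s θ h) (spec_dom_inv h) := rfl

theorem dom_idem (e : Idem S) : dom e.1 = e :=
  Subtype.ext (by change e.1⁻¹ * e.1 = e.1; rw [idem_inv e.2, e.2])

theorem exists_idem (θ : Spectrum S) : ∃ e : Idem S, θ (dom e.1) = true := by
  obtain ⟨e, he⟩ := θ.exists_one
  exact ⟨e, by rw [dom_idem]; exact he⟩

/-- The identity germ `[e, θ]` at `θ`, where `e` is any idempotent with `θ ∈ D(e)`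
(see `germOne_eq`). -/
noncomputable def germOne (θ : Spectrum S) : Germ S :=
  germ (exists_idem θ).choose.1 θ (exists_idem θ).choose_spec

theorem germOne_eq (θ : Spectrum S) (e : Idem S) (he : θ (dom e.1) = true) :
    germOne θ = germ e.1 θ he := by
  have h0 := (exists_idem θ).choose_spec
  unfold germOne
  generalize_proofs
  set f := (exists_idem θ).choose
  refine germ_congr rfl _ _ (f * e) ?_ ?_
  · rw [dom_idem] at he h0
    rw [θ.map_mul, he, h0]
    rfl
  · change f.1 * (f.1 * e.1) = e.1 * (f.1 * e.1)
    rw [← mul_assoc, f.2, ← mul_assoc, idem_comm e.2 f.2, mul_assoc, e.2]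

theorem beta_idem (e : Idem S) (θ : Spectrum S) (he : θ (dom e.1) = true) :
    beta e.1 θ he = θ := by
  apply spectrum_ext
  intro f
  have : conj e.1 f = e * f * e := Subtype.ext (by
    change e.1⁻¹ * f.1 * e.1 = e.1 * f.1 * e.1
    rw [idem_inv e.2])
  rw [dom_idem] at he
  rw [beta_apply, this, θ.map_mul, θ.map_mul, he, Bool.and_true, Bool.true_and]

theorem beta_mul {s t : S} {θ : Spectrum S} (ht : θ (dom t) = true)
    (hs : beta t θ ht (dom s) = true) (hst : θ (dom (s * t)) = true) :
    beta (s * t) θ hst = beta s (beta t θ ht) hs := by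
  apply spectrum_ext
  intro f
  rw [beta_apply, beta_apply, beta_apply]
  congr 1
  apply Subtype.ext
  change (s * t)⁻¹ * f.1 * (s * t) = t⁻¹ * (s⁻¹ * f.1 * s) * t
  rw [mul_inv_rev']
  simp only [mul_assoc]

theorem beta_inv {s : S} {θ : Spectrum S} (hs : θ (dom s) = true) :
    beta s⁻¹ (beta s θ hs) (spec_dom_inv hs) = θ := by
  have h := spec_dom_comp hs (spec_dom_inv hs)
  rw [← beta_mul hs (spec_dom_inv hs) h]
  exact beta_idem (dom s) θ h

end InverseSemigroup

/-! Groupoids, given by a set `X` of objects and a set `Γ` of arrows. -/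

/-- A groupoid with set of objects `X` and set of arrows `Γ`; the product `g h` is defined
when `d g = r h`. -/
structure ArrowGroupoid (X : Type u) (Γ : Type v) where
  d : Γ → X
  r : Γ → X
  one : X → Γ
  inv : Γ → Γ
  mul : (g h : Γ) → d g = r h → Γ
  d_one : ∀ x, d (one x) = x
  r_one : ∀ x, r (one x) = x
  d_inv : ∀ g, d (inv g) = r g
  r_inv : ∀ g, r (inv g) = d g
  d_mul : ∀ g h hgh, d (mul g h hgh) = d h
  r_mul : ∀ g h hgh, r (mul g h hgh) = r g
  mul_assoc : ∀ g h k (h₁ : d g = r h) (h₂ : d h = r k) (h₃ : d (mul g h h₁) = r k)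
    (h₄ : d g = r (mul h k h₂)), mul (mul g h h₁) k h₃ = mul g (mul h k h₂) h₄
  one_mul : ∀ g (h : d (one (r g)) = r g), mul (one (r g)) g h = g
  mul_one : ∀ g (h : d g = r (one (d g))), mul g (one (d g)) h = g
  inv_mul : ∀ g (h : d (inv g) = r g), mul (inv g) g h = one (d g)
  mul_inv : ∀ g (h : d g = r (inv g)), mul g (inv g) h = one (r g)

namespace ArrowGroupoid

variable {X : Type u} {Γ : Type v} (𝒢 : ArrowGroupoid X Γ)

/-- The isotropy subgroupoid `{g | d g = r g}`. -/
def Iso : Set Γ := {g | 𝒢.d g = 𝒢.r g}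

/-- The (set of elements of the) isotropy group at `x`. -/
def isotropyAt (x : X) : Set Γ := {g | 𝒢.d g = x ∧ 𝒢.r g = x}

/-- A set of objects is invariant if it is a union of orbits. -/
def IsInvariant (U : Set X) : Prop := ∀ g, 𝒢.d g ∈ U ↔ 𝒢.r g ∈ U

/-- The convolution product `(f * k)(γ) = ∑_{α β = γ} f(α) k(β)`; the sum has finitely many
non-zero terms if `f` and `k` belong to the Steinberg algebra. -/
noncomputable def conv {K : Type w} [Field K] (f k : Γ → K) : Γ → K := fun γ =>
  ∑ᶠ p : {p : Γ × Γ // ∃ h : 𝒢.d p.1 = 𝒢.r p.2, 𝒢.mul p.1 p.2 h = γ}, f p.1.1 * k p.1.2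

variable [TopologicalSpace X] [TopologicalSpace Γ]

/-- A topological groupoid: the structure maps are continuous, and the object space is
the unit space with the subspace topology. -/
structure IsTopological : Prop where
  continuous_d : Continuous 𝒢.d
  continuous_r : Continuous 𝒢.r
  continuous_inv : Continuous 𝒢.inv
  continuous_mul :
    Continuous fun p : {p : Γ × Γ // 𝒢.d p.1 = 𝒢.r p.2} => 𝒢.mul p.1.1 p.1.2 p.2
  isEmbedding_one : Topology.IsEmbedding 𝒢.one

/-- An ample groupoid: an étale topological groupoid (the domain map is a local
homeomorphism) whose unit space is locally compact Hausdorff with a basis of compact open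
sets. The arrow space need not be Hausdorff. -/
structure IsAmple : Prop extends 𝒢.IsTopological where
  isLocalHomeomorph_d : IsLocalHomeomorph 𝒢.d
  locallyCompact : LocallyCompactSpace X
  hausdorff : T2Space X
  basis : TopologicalSpace.IsTopologicalBasis {U : Set X | IsCompact U ∧ IsOpen U}

/-- There are no proper non-empty open invariant sets of objects. -/
def IsMinimal : Prop :=
  ∀ U : Set X, IsOpen U → 𝒢.IsInvariant U → U = ∅ ∨ U = Set.univ

/-- The interior of the isotropy subgroupoid is the unit space. -/
def IsEffective : Prop := interior 𝒢.Iso = Set.range 𝒢.one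

/-- The objects with trivial isotropy group are dense in the unit space. -/
def IsTopologicallyPrincipal : Prop :=
  Dense {x : X | 𝒢.isotropyAt x = {𝒢.one x}}

/-- A local bisection is an open set of arrows on which `d` and `r` are homeomorphisms
onto their images. -/
def IsLocalBisection (U : Set Γ) : Prop :=
  IsOpen U ∧ Topology.IsEmbedding (U.domRestrict 𝒢.d) ∧ Topology.IsEmbedding (U.domRestrict 𝒢.r)

/-- The Steinberg algebra: the span of the characteristic functions of the compact local
bisections; its product is `conv`. -/
noncomputable def steinberg (K : Type w) [Field K] : Submodule K (Γ → K) :=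
  Submodule.span K {f | ∃ U : Set Γ, 𝒢.IsLocalBisection U ∧ IsCompact U ∧
    f = U.indicator (fun _ => 1)}

/-- The Steinberg algebra is simple: its multiplication is not zero and it has
no two-sided ideals other than `0` and itself. -/
def SteinbergIsSimple (K : Type w) [Field K] : Prop :=
  (∃ f ∈ 𝒢.steinberg K, ∃ k ∈ 𝒢.steinberg K, 𝒢.conv f k ≠ 0) ∧
  ∀ I : AddSubgroup (Γ → K), I ≤ (𝒢.steinberg K).toAddSubgroup →
    (∀ f ∈ 𝒢.steinberg K, ∀ k ∈ I, 𝒢.conv f k ∈ I ∧ 𝒢.conv k f ∈ I) →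
    I = ⊥ ∨ I = (𝒢.steinberg K).toAddSubgroup

end ArrowGroupoid

/-! The universal groupoid. -/

section Universal

variable (S : Type u) [InverseSemigroupWithZero S]

open InverseSemigroupWithZero

/-- The (contracted) universal groupoid of `S`: the groupoid of germs of the action of `S`
on the spectrum of `E(S)`. -/
noncomputable def universalGroupoid : ArrowGroupoid (Spectrum S) (Germ S) where
  d := germDom
  r := germRan
  one := germOne
  inv := germInv
  mul := germMul
  d_one _ := rfl
  r_one θ := by
    obtain ⟨e, he⟩ := exists_idem θ
    rw [germOne_eq θ e he, germRan_germ, beta_idem]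
  d_inv g := by
    obtain ⟨s, θ, h, rfl⟩ := germ_surj g
    rfl
  r_inv g := by
    obtain ⟨s, θ, h, rfl⟩ := germ_surj g
    exact beta_inv h
  d_mul _ _ _ := rfl
  r_mul g k hgk := by
    obtain ⟨s, η, hs, rfl⟩ := germ_surj g
    obtain ⟨t, θ, ht, rfl⟩ := germ_surj k
    have h' : η = beta t θ ht := hgk
    subst h'
    have c := spec_dom_comp ht hs
    rw [germMul_germ hs ht hgk c]
    exact beta_mul ht hs c
  mul_assoc g h k h₁ h₂ h₃ h₄ := by
    obtain ⟨s, η, hs, rfl⟩ := germ_surj g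
    obtain ⟨t, θ, ht, rfl⟩ := germ_surj h
    obtain ⟨x, ζ, hx, rfl⟩ := germ_surj k
    have e1 : η = beta t θ ht := h₁
    subst e1
    have e2 : θ = beta x ζ hx := h₂
    subst e2
    have a := spec_dom_comp ht hs
    have b := spec_dom_comp hx ht
    have c := spec_dom_comp hx a
    have c' : ζ (dom (s * (t * x))) = true := by rw [← mul_assoc]; exact c
    have k1 := germMul_germ hs ht h₁ a
    have k2 := germMul_germ ht hx h₂ b
    simp only [k1, k2]
    rw [germMul_germ a hx _ c, germMul_germ hs b _ c']
    simp only [mul_assoc]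
  one_mul g h := by
    obtain ⟨s, θ, hs, rfl⟩ := germ_surj g
    have e : beta s θ hs (dom (dom s⁻¹).1) = true := by
      rw [dom_idem]; exact spec_dom_inv hs
    have k1 : germOne (germRan (germ s θ hs)) = germ (dom s⁻¹).1 (beta s θ hs) e :=
      germOne_eq _ _ e
    have hs' : (dom s⁻¹).1 * s = s := by
      change s⁻¹⁻¹ * s⁻¹ * s = s
      rw [inv_inv', mul_inv_mul]
    have c : θ (dom ((dom s⁻¹).1 * s)) = true := by rw [hs']; exact hs
    simp only [k1]
    rw [germMul_germ e hs _ c]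
    simp only [hs']
  mul_one g h := by
    obtain ⟨s, θ, hs, rfl⟩ := germ_surj g
    have e : θ (dom (dom s).1) = true := by rw [dom_idem]; exact hs
    have k1 : germOne (germDom (germ s θ hs)) = germ (dom s).1 θ e := germOne_eq _ _ e
    have hs' : s * (dom s).1 = s := by
      change s * (s⁻¹ * s) = s
      rw [← mul_assoc, mul_inv_mul]
    have c : θ (dom (s * (dom s).1)) = true := by rw [hs']; exact hs
    simp only [k1]
    rw [germMul_germ hs e _ c]
    simp only [hs']
  inv_mul g h := by
    obtain ⟨s, θ, hs, rfl⟩ := germ_surj g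
    have c : θ (dom (s⁻¹ * s)) = true := spec_dom_comp hs (spec_dom_inv hs)
    simp only [germInv_germ]
    rw [germMul_germ (spec_dom_inv hs) hs _ c]
    exact (germOne_eq θ (dom s) c).symm
  mul_inv g h := by
    obtain ⟨s, θ, hs, rfl⟩ := germ_surj g
    have e := spec_dom_inv hs
    have c : beta s θ hs (dom (s * s⁻¹)) = true := spec_dom_comp e (by
      rw [beta_inv hs]; exact hs)
    simp only [germInv_germ]
    rw [germMul_germ hs e _ c]
    exact (germOne_eq (beta s θ hs) ⟨s * s⁻¹, mul_inv_idem s⟩ c).symm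

variable {S} in
/-- The basic set `(s, U) = {[s, θ] : θ ∈ U}`, where `U ⊆ D(s* s)`. -/
def germSet (s : S) (U : Set (Spectrum S)) (hU : U ⊆ D (dom s)) : Set (Germ S) :=
  {g | ∃ (θ : Spectrum S) (h : θ ∈ U), g = germ s θ (hU h)}

/-- The topology on the set of germs with basis the sets `(s, U)`, for `U` an open subset of
`D(s* s)`. -/
instance : TopologicalSpace (Germ S) :=
  TopologicalSpace.generateFrom
    {W | ∃ (s : S) (U : Set (Spectrum S)) (hU : U ⊆ D (dom s)), IsOpen U ∧ W = germSet s U hU}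

end Universal

/-! Self-similar group actions. -/

/-- A self-similar action of the group `G` over the alphabet `X`: maps `(g, x) ↦ g(x)` and
`(g, x) ↦ g|ₓ`. They extend to words by `actWord` and `secWord`, and the laws below are
equivalent to the laws for the extended maps (`actWord_one`, `actWord_mul`, `secWord_one`,
`secWord_mul`). -/
structure SelfSimilarAction (G : Type u) (X : Type v) [Group G] where
  act : G → X → X
  sec : G → X → G
  one_act : ∀ x, act 1 x = x
  mul_act : ∀ g h x, act (g * h) x = act g (act h x)
  one_sec : ∀ x, sec 1 x = 1
  mul_sec : ∀ g h x, sec (g * h) x = sec g (act h x) * sec h x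

namespace SelfSimilarAction

variable {G : Type u} {X : Type v} [Group G] (σ : SelfSimilarAction G X)

/-- The action on words: `g(x w) = g(x) g|ₓ(w)`. -/
def actWord : G → List X → List X
  | _, [] => []
  | g, x :: w => σ.act g x :: actWord (σ.sec g x) w

/-- The sections at words: `g|_{x w} = (g|ₓ)|_w`. -/
def secWord : G → List X → G
  | g, [] => g
  | g, x :: w => secWord (σ.sec g x) w

/-- The action of `G` on words is faithful. -/
def IsFaithful : Prop := ∀ g : G, (∀ w, σ.actWord g w = w) → g = 1

theorem actWord_one (w : List X) : σ.actWord 1 w = w := by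
  induction w with
  | nil => rfl
  | cons x w ih => simp [actWord, σ.one_act, σ.one_sec, ih]

theorem secWord_one (w : List X) : σ.secWord 1 w = 1 := by
  induction w with
  | nil => rfl
  | cons x w ih => simp [secWord, σ.one_sec, ih]

theorem actWord_mul (g h : G) (w : List X) :
    σ.actWord (g * h) w = σ.actWord g (σ.actWord h w) := by
  induction w generalizing g h with
  | nil => rfl
  | cons x w ih => simp [actWord, σ.mul_act, σ.mul_sec, ih]

theorem secWord_mul (g h : G) (w : List X) :
    σ.secWord (g * h) w = σ.secWord g (σ.actWord h w) * σ.secWord h w := by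
  induction w generalizing g h with
  | nil => rfl
  | cons x w ih => simp [actWord, secWord, σ.mul_sec, ih]

theorem actWord_append (g : G) (v w : List X) :
    σ.actWord g (v ++ w) = σ.actWord g v ++ σ.actWord (σ.secWord g v) w := by
  induction v generalizing g with
  | nil => rfl
  | cons x v ih => simp [actWord, secWord, ih]

theorem secWord_append (g : G) (v w : List X) :
    σ.secWord g (v ++ w) = σ.secWord (σ.secWord g v) w := by
  induction v generalizing g with
  | nil => rfl
  | cons x v ih => simp [secWord, ih]

theorem actWord_inv_act (g : G) (w : List X) : σ.actWord g⁻¹ (σ.actWord g w) = w := by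
  rw [← actWord_mul, inv_mul_cancel, actWord_one]

theorem actWord_act_inv (g : G) (w : List X) : σ.actWord g (σ.actWord g⁻¹ w) = w := by
  rw [← actWord_mul, mul_inv_cancel, actWord_one]

/-- The inverse semigroup of the self-similar action: `0` and the elements `u g v*`, with
`u, v` words and `g ∈ G`. -/
inductive Hull (σ : SelfSimilarAction G X) : Type (max u v)
  | zero : Hull σ
  | tri (u : List X) (g : G) (v : List X) : Hull σ

open Classical in
/-- The product `u g v* · w h z*`, by the rules `g x = g(x) g|ₓ`,
`x* g = g|_{g⁻¹(x)} (g⁻¹(x))*`, `x* x = 1` and `x* y = 0` if `x ≠ y`. -/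
noncomputable def prod (u : List X) (g : G) : List X → List X → G → List X → Hull σ
  | [], w, h, z => Hull.tri (u ++ σ.actWord g w) (σ.secWord g w * h) z
  | x :: v, [], h, z =>
      Hull.tri u (g * σ.secWord h (σ.actWord h⁻¹ (x :: v))) (z ++ σ.actWord h⁻¹ (x :: v))
  | x :: v, y :: w, h, z => if x = y then prod u g v w h z else Hull.zero

noncomputable def hullMul : Hull σ → Hull σ → Hull σ
  | Hull.tri u g v, Hull.tri w h z => σ.prod u g v w h z
  | _, _ => Hull.zero

def hullInv : Hull σ → Hull σ
  | Hull.tri u g v => Hull.tri v g⁻¹ u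
  | Hull.zero => Hull.zero

open Classical in
/-- `strip v m` is `m'` if `m = v m'`, and is undefined if `v` is not a prefix of `m`. -/
noncomputable def strip : List X → List X → Option (List X)
  | [], m => some m
  | _ :: _, [] => none
  | x :: v, y :: m => if x = y then strip v m else none

theorem strip_eq_some {v m k : List X} : strip v m = some k ↔ m = v ++ k := by
  induction v generalizing m with
  | nil => simp [strip]
  | cons x v ih =>
    cases m with
    | nil => simp [strip]
    | cons y m =>
      by_cases h : x = y
      · simp [strip, h, ih]
      · simp [strip, h, Ne.symm h]

theorem strip_append (v z m : List X) : strip (z ++ v) m = (strip z m).bind (strip v) := by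
  ext k
  rw [Option.bind_eq_some_iff, strip_eq_some]
  constructor
  · intro h
    exact ⟨v ++ k, strip_eq_some.2 (by rw [h, List.append_assoc]), strip_eq_some.2 rfl⟩
  · rintro ⟨a, ha, hb⟩
    rw [strip_eq_some] at ha hb
    rw [ha, hb, List.append_assoc]

theorem strip_act (h : G) (v m : List X) :
    strip v (σ.actWord h m) = (strip (σ.actWord h⁻¹ v) m).map
      (σ.actWord (σ.secWord h (σ.actWord h⁻¹ v))) := by
  ext k
  rw [Option.map_eq_some_iff, strip_eq_some]
  constructor
  · intro e
    have hm : m = σ.actWord h⁻¹ v ++ σ.actWord (σ.secWord h⁻¹ v) k := by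
      rw [← actWord_append, ← e, actWord_inv_act]
    refine ⟨_, strip_eq_some.2 hm, ?_⟩
    rw [← actWord_mul, ← secWord_mul, mul_inv_cancel, secWord_one, actWord_one]
  · rintro ⟨a, ha, rfl⟩
    rw [strip_eq_some] at ha
    rw [ha, actWord_append, actWord_act_inv]

/-- The elements of `Hull σ` as partial maps on the monoid `X* G`:
`u g v*` sends `v m k` to `u g(m) g|_m k`. -/
noncomputable def rho : Hull σ → List X × G → Option (List X × G)
  | Hull.zero, _ => none
  | Hull.tri u g v, (m, k) =>
      (strip v m).map fun m' => (u ++ σ.actWord g m', σ.secWord g m' * k)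

theorem rho_prod (u : List X) (g : G) (v w : List X) (h : G) (z : List X)
    (p : List X × G) :
    σ.rho (σ.prod u g v w h z) p = (σ.rho (Hull.tri w h z) p).bind (σ.rho (Hull.tri u g v)) := by
  obtain ⟨m, k⟩ := p
  induction v generalizing w with
  | nil =>
    cases hs : strip z m with
    | none => simp [rho, prod, hs]
    | some a =>
      simp [rho, prod, hs, strip, actWord_append, secWord_append, actWord_mul, secWord_mul,
        mul_assoc]
  | cons x v ih =>
    cases w with
    | nil =>
      cases hs : strip z m with
      | none => simp [rho, prod, hs, strip_append]
      | some a =>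
        simp only [rho, prod, hs, strip_append, Option.bind_some, Option.map_some,
          List.nil_append]
        rw [strip_act]
        cases hb : strip (σ.actWord h⁻¹ (x :: v)) a with
        | none => simp
        | some b =>
          rw [strip_eq_some] at hb
          subst hb
          simp [actWord_mul, secWord_mul, secWord_append, mul_assoc]
    | cons y w =>
      by_cases hxy : x = y
      · subst hxy
        have := ih w
        cases hs : strip z m with
        | none => simpa [rho, prod, hs] using this
        | some a => simpa [rho, prod, hs, strip] using this
      · cases hs : strip z m with
        | none => simp [rho, prod, hs, hxy]
        | some a => simp [rho, prod, hs, strip, hxy]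

theorem rho_mul (s t : Hull σ) (p : List X × G) :
    σ.rho (σ.hullMul s t) p = (σ.rho t p).bind (σ.rho s) := by
  cases s with
  | zero =>
    have : σ.rho (Hull.zero : Hull σ) = fun _ => none := by funext q; rfl
    rw [this]
    cases t <;> simp [hullMul, rho]
  | tri u g v =>
    cases t with
    | zero => simp [hullMul, rho]
    | tri w h z => exact σ.rho_prod u g v w h z p

theorem rho_tri_self (u : List X) (g : G) (v : List X) (k : G) :
    σ.rho (Hull.tri u g v) (v, k) = some (u, g * k) := by
  have : strip v v = some [] := strip_eq_some.2 (by simp)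
  simp [rho, this, actWord, secWord]

theorem rho_injective {s t : Hull σ} (h : ∀ p, σ.rho s p = σ.rho t p) : s = t := by
  cases s with
  | zero =>
    cases t with
    | zero => rfl
    | tri w k z =>
      have := h (z, 1)
      rw [rho_tri_self] at this
      cases this
  | tri u g v =>
    have h1 := h (v, 1)
    rw [rho_tri_self] at h1
    cases t with
    | zero => cases h1
    | tri w k z =>
      have h2 := h (z, 1)
      rw [rho_tri_self] at h2
      have hvz : v = z := by
        simp only [rho] at h1 h2
        obtain ⟨a, ha, -⟩ := Option.map_eq_some_iff.1 h1.symm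
        obtain ⟨b, hb, -⟩ := Option.map_eq_some_iff.1 h2
        rw [strip_eq_some] at ha hb
        rw [ha, List.append_assoc, ← List.append_nil z] at hb
        simp only [List.append_assoc, List.nil_append] at hb
        have hab := List.append_cancel_left hb
        have ha' : a = [] := (List.append_eq_nil_iff.1 hab.symm).1
        rw [ha, ha', List.append_nil]
      subst hvz
      rw [rho_tri_self] at h1
      simp only [mul_one, Option.some.injEq, Prod.mk.injEq] at h1
      rw [h1.1, h1.2]

theorem hullMul_assoc (s t x : Hull σ) :
    σ.hullMul (σ.hullMul s t) x = σ.hullMul s (σ.hullMul t x) := by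
  apply σ.rho_injective
  intro p
  simp only [rho_mul]
  cases σ.rho x p <;> simp

theorem prod_self (u : List X) (g : G) (v : List X) (h : G) (z : List X) :
    σ.prod u g v v h z = Hull.tri u (g * h) z := by
  induction v with
  | nil => simp [prod, actWord, secWord]
  | cons x v ih => simp [prod, ih]

theorem hull_idem {e : Hull σ} (he : σ.hullMul e e = e) :
    e = Hull.zero ∨ ∃ u, e = Hull.tri u 1 u := by
  cases e with
  | zero => exact Or.inl rfl
  | tri u g v =>
    right
    have h := σ.rho_mul (Hull.tri u g v) (Hull.tri u g v) (v, 1)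
    rw [he, rho_tri_self, Option.bind_some] at h
    simp only [rho] at h
    obtain ⟨a, ha, hb⟩ := Option.map_eq_some_iff.1 h.symm
    simp only [Prod.mk.injEq, List.append_right_eq_self] at hb
    have ha0 : a = [] := by
      cases a with
      | nil => rfl
      | cons => simp [actWord] at hb
    subst ha0
    rw [strip_eq_some, List.append_nil] at ha
    subst ha
    simp only [secWord, mul_one] at hb
    exact ⟨u, by rw [mul_eq_left.1 hb.2]⟩

theorem rho_idem (u : List X) (p q : List X × G) :
    σ.rho (Hull.tri u 1 u) p = some q ↔ p = q ∧ u <+: p.1 := by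
  obtain ⟨m, k⟩ := p
  simp only [rho, Option.map_eq_some_iff, strip_eq_some, actWord_one, secWord_one, one_mul]
  constructor
  · rintro ⟨a, rfl, rfl⟩
    exact ⟨rfl, List.prefix_append u a⟩
  · rintro ⟨rfl, a, rfl⟩
    exact ⟨a, rfl, rfl⟩

theorem hull_idem_comm {e f : Hull σ} (he : σ.hullMul e e = e) (hf : σ.hullMul f f = f) :
    σ.hullMul e f = σ.hullMul f e := by
  obtain rfl | ⟨u, rfl⟩ := σ.hull_idem he
  · cases f <;> rfl
  obtain rfl | ⟨w, rfl⟩ := σ.hull_idem hf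
  · rfl
  apply σ.rho_injective
  intro p
  ext q
  simp only [rho_mul, Option.bind_eq_some_iff, rho_idem]
  aesop

theorem hull_mul_inv_mul (s : Hull σ) : σ.hullMul (σ.hullMul s (σ.hullInv s)) s = s := by
  cases s with
  | zero => rfl
  | tri u g v => simp [hullMul, hullInv, prod_self]

theorem hull_inv_mul_inv (s : Hull σ) :
    σ.hullMul (σ.hullMul (σ.hullInv s) s) (σ.hullInv s) = σ.hullInv s := by
  cases s with
  | zero => rfl
  | tri u g v => simp [hullMul, hullInv, prod_self]

noncomputable instance : SemigroupWithZero (Hull σ) where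
  mul := σ.hullMul
  mul_assoc := σ.hullMul_assoc
  zero := Hull.zero
  zero_mul _ := rfl
  mul_zero s := by cases s <;> rfl

noncomputable instance : InverseSemigroupWithZero (Hull σ) where
  inv := σ.hullInv
  mul_inv_mul := σ.hull_mul_inv_mul
  inv_mul_inv := σ.hull_inv_mul_inv
  inv_unique s t h1 h2 := by
    have h3 : s * σ.hullInv s * s = s := σ.hull_mul_inv_mul s
    have h4 : σ.hullInv s * s * σ.hullInv s = σ.hullInv s := σ.hull_inv_mul_inv s
    change t = σ.hullInv s
    generalize σ.hullInv s = x at h3 h4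
    have comm : ∀ a b : Hull σ, a * a = a → b * b = b → a * b = b * a :=
      fun a b ha hb => σ.hull_idem_comm ha hb
    have c1 : (t * s) * (x * s) = (x * s) * (t * s) := comm _ _
      (by rw [← mul_assoc, h2]) (by rw [← mul_assoc, h4])
    have c2 : (s * x) * (s * t) = (s * t) * (s * x) := comm _ _
      (by rw [← mul_assoc, h3]) (by rw [← mul_assoc, h1])
    have d1 : t * s = x * s := by
      calc t * s = t * (s * x * s) := by rw [h3]
        _ = (t * s) * (x * s) := by simp only [mul_assoc]
        _ = x * (s * t * s) := by rw [c1]; simp only [mul_assoc]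
        _ = x * s := by rw [h1]
    have d2 : s * t = s * x := by
      calc s * t = (s * x * s) * t := by rw [h3]
        _ = (s * x) * (s * t) := by simp only [mul_assoc]
        _ = (s * t * s) * x := by rw [c2]; simp only [mul_assoc]
        _ = s * x := by rw [h1]
    calc t = t * s * t := h2.symm
      _ = x * (s * t) := by rw [d1, mul_assoc]
      _ = x := by rw [d2, ← mul_assoc, h4]

end SelfSimilarAction

/-- The group `∏_{p ∈ P} C_p × C_p`. -/
abbrev PrimeProduct (P : Set ℕ) : Type :=
  (p : P) → Multiplicative (ZMod p) × Multiplicative (ZMod p)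

end AmpleGpd

/-! A letter consists of a prime p in P, a linear form on C_p × C_p up to scaling (a point of the
projective line over F_p), a copy number in ℕ and a value in ZMod p. A group element translates the
value by the form of its p-th component, and its section forgets that component. So the first letter
at p in a word tests the p-th component along one line direction, and nothing of this component is
left for later letters. The copies in ℕ ensure that the exclusion of finitely many letters loses no
information.

A character of the idempotents is a finite or infinite word, described by its set of prefixes
(`char_ext`). Its neighbourhoods fix a prefix and exclude finitely many next letters
(`exists_nbhd_subset`). Minimality holds because every character can be moved behind a prefix `w y`
with a non-excluded letter `y`. Effectiveness holds because every non-trivial g moves a non-excluded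
letter (`primeAction_moves`).

Simplicity is reduced to the group algebra by `steinbergIsSimple_of_reduce`: a non-zero element of
an ideal is compressed by words on both sides to a non-zero element of K G, and then by maps g ↦ y'*
g y to a multiple of one group element, which is invertible. That compression does not kill
everything is affine plane geometry (`sum_lineForm_eq`): if all sums over lines vanish, then adding
those over the p + 1 lines through a point leaves p times the coefficient there, so the coefficient
is zero if p is invertible in K (`exists_reduce_ne_zero`). If p = 0 in K, the sum N of all elements
of C_p × C_p is non-zero, but it vanishes at every character with a letter at p, since there its
germs coincide along the p-element cosets of a line. The functions that vanish over the characters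
with infinitely many letters at p then form a proper non-zero ideal (`not_steinbergIsSimple`).

For the isotropy, at every character and for each p some non-trivial element of C_p × C_p fixes all
prefixes (`exists_mulSingle_fixing`). The products of these over subsets of P are in the isotropy
group, and two of them have equal germs only if the subsets differ by a finite set, because a finite
word deletes finitely many components. -/

open Topology

namespace AmpleGpd

universe u v w

/-! ### Topology of the universal groupoid: it is ample. -/

section UniversalTopology

variable {S : Type u} [InverseSemigroupWithZero S]

open InverseSemigroupWithZero

/-! The spectrum. -/

theorem isEmbedding_spectrum_toFun :
    IsEmbedding (Spectrum.toFun : Spectrum S → Idem S → Bool) :=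
  ⟨⟨rfl⟩, fun _ _ h => spectrum_ext fun e => congrFun h e⟩

theorem continuous_spectrum_eval (e : Idem S) : Continuous fun θ : Spectrum S => θ e :=
  (continuous_apply e).comp isEmbedding_spectrum_toFun.continuous

theorem isClopen_D (e : Idem S) : IsClopen (D e) :=
  (isClopen_discrete {true}).preimage (continuous_spectrum_eval e)

/-- The value 1 at e makes a character non-zero, so this set is cut out of the cube by closed
conditions alone. The non-vanishing condition on its own would not be closed. -/
theorem isCompact_D (e : Idem S) : IsCompact (D e) := by
  rw [isEmbedding_spectrum_toFun.isCompact_iff]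
  have : Spectrum.toFun '' (D e) = {f : Idem S → Bool | f e = true} ∩ ({f | f 0 = false} ∩
      ⋂ a : Idem S, ⋂ b : Idem S, {f | f (a * b) = (f a && f b)}) := by
    ext f
    simp only [Set.mem_image, Set.mem_inter_iff, Set.mem_ofPred_eq, Set.mem_iInter]
    constructor
    · rintro ⟨θ, hθ, rfl⟩
      exact ⟨hθ, θ.map_zero, θ.map_mul⟩
    · rintro ⟨h1, h2, h3⟩
      exact ⟨⟨f, h2, h3, e, h1⟩, h1, rfl⟩
  rw [this]
  apply IsClosed.isCompact
  refine (isClosed_eq (continuous_apply e) continuous_const).inter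
    ((isClosed_eq (continuous_apply _) continuous_const).inter
      (isClosed_iInter fun a => isClosed_iInter fun b => ?_))
  have hc : Continuous fun p : Bool × Bool => (p.1 && p.2) := continuous_of_discreteTopology
  have hab : Continuous fun f : Idem S → Bool => (f a, f b) :=
    (continuous_apply a).prodMk (continuous_apply b)
  exact isClosed_eq (continuous_apply _) (hc.comp hab)

instance : T2Space (Spectrum S) := isEmbedding_spectrum_toFun.t2Space

/-- A neighbourhood of `θ` contains all characters that agree with `θ` on a finite set. -/
theorem exists_finset_of_isOpen {V : Set (Spectrum S)} (hV : IsOpen V) {θ : Spectrum S}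
    (hθ : θ ∈ V) : ∃ E : Finset (Idem S), ∀ η : Spectrum S, (∀ e ∈ E, η e = θ e) → η ∈ V := by
  obtain ⟨W, hW, rfl⟩ := isOpen_induced_iff.1 hV
  obtain ⟨E, A, hA, hE⟩ := isOpen_pi_iff.1 hW θ.toFun hθ
  refine ⟨E, fun η h => hE fun e he => ?_⟩
  rw [h e he]
  exact (hA e he).2

theorem isTopologicalBasis_compact_open :
    TopologicalSpace.IsTopologicalBasis {U : Set (Spectrum S) | IsCompact U ∧ IsOpen U} := by
  refine TopologicalSpace.isTopologicalBasis_of_isOpen_of_nhds (fun U h => h.2) ?_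
  intro θ V hθ hV
  obtain ⟨E, hE⟩ := exists_finset_of_isOpen hV hθ
  obtain ⟨e, he⟩ := θ.exists_one
  have hc : IsClopen (⋂ f ∈ E, {η : Spectrum S | η f = θ f}) :=
    isClopen_biInter_finset fun f _ =>
      (isClopen_discrete {θ f}).preimage (continuous_spectrum_eval f)
  refine ⟨D e ∩ ⋂ f ∈ E, {η : Spectrum S | η f = θ f},
    ⟨(isCompact_D e).inter_right hc.isClosed, (isClopen_D e).isOpen.inter hc.isOpen⟩,
    ⟨he, by simp⟩, fun η h => hE η ?_⟩
  simpa using h.2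

instance : LocallyCompactSpace (Spectrum S) := by
  have : WeaklyLocallyCompactSpace (Spectrum S) := ⟨fun θ => by
    obtain ⟨e, he⟩ := θ.exists_one
    exact ⟨D e, isCompact_D e, (isClopen_D e).isOpen.mem_nhds he⟩⟩
  infer_instance

/-! The topology on the germs. -/

theorem germ_mem_germSet {s t : S} {θ : Spectrum S} {h : θ (dom t) = true}
    {U : Set (Spectrum S)} {hU : U ⊆ D (dom s)} :
    germ t θ h ∈ germSet s U hU ↔ θ ∈ U ∧ ∃ e : Idem S, θ e = true ∧ t * e.1 = s * e.1 := by
  constructor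
  · rintro ⟨η, hη, he⟩
    obtain ⟨rfl, h'⟩ := germ_eq_iff.1 he
    exact ⟨hη, h'⟩
  · rintro ⟨h1, e, h2, h3⟩
    exact ⟨θ, h1, germ_congr rfl _ _ e h2 h3⟩

theorem germ_mem_germSet_self {s : S} {θ : Spectrum S} {U : Set (Spectrum S)}
    {hU : U ⊆ D (dom s)} (hθ : θ ∈ U) : germ s θ (hU hθ) ∈ germSet s U hU :=
  ⟨θ, hθ, rfl⟩

/-- If s and t have the same germ at θ, then s e = t e for some e with θ in D(e), so their germs
agree on all of D(e). This gives a common basic neighbourhood. -/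
theorem isTopologicalBasis_germSet : TopologicalSpace.IsTopologicalBasis
    {W : Set (Germ S) | ∃ (s : S) (U : Set (Spectrum S)) (hU : U ⊆ D (dom s)),
      IsOpen U ∧ W = germSet s U hU} where
  exists_subset_inter := by
    rintro _ ⟨s, U, hU, oU, rfl⟩ _ ⟨t, V, hV, oV, rfl⟩ γ ⟨h1, h2⟩
    obtain ⟨θ, hθ, rfl⟩ := h1
    obtain ⟨hθ', e, he, hst⟩ := germ_mem_germSet.1 h2
    have hs : U ∩ V ∩ D e ⊆ D (dom s) := fun η h => hU h.1.1
    refine ⟨germSet s (U ∩ V ∩ D e) hs, ⟨s, _, hs, (oU.inter oV).inter (isClopen_D e).isOpen, rfl⟩,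
      germ_mem_germSet_self (hU := hs) ⟨⟨hθ, hθ'⟩, he⟩, ?_⟩
    rintro _ ⟨η, hη, rfl⟩
    exact ⟨germ_mem_germSet_self (hU := hU) hη.1.1, germ_mem_germSet.2 ⟨hη.1.2, e, hη.2, hst⟩⟩
  sUnion_eq := by
    rw [Set.eq_univ_iff_forall]
    intro γ
    obtain ⟨s, θ, h, rfl⟩ := germ_surj γ
    exact ⟨_, ⟨s, D (dom s), subset_rfl, (isClopen_D _).isOpen, rfl⟩,
      germ_mem_germSet_self (hU := subset_rfl) h⟩
  eq_generateFrom := rfl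

theorem isOpen_germSet {s : S} {U : Set (Spectrum S)} (hU : U ⊆ D (dom s)) (oU : IsOpen U) :
    IsOpen (germSet s U hU) :=
  isTopologicalBasis_germSet.isOpen ⟨s, U, hU, oU, rfl⟩

/-- An open set that contains `[s, θ]` contains `[s, η]` for all `η` near `θ`. -/
theorem exists_germSet_subset {W : Set (Germ S)} (hW : IsOpen W) {s : S} {θ : Spectrum S}
    {h : θ (dom s) = true} (hθ : germ s θ h ∈ W) :
    ∃ (U : Set (Spectrum S)) (hU : U ⊆ D (dom s)), IsOpen U ∧ θ ∈ U ∧ germSet s U hU ⊆ W := by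
  obtain ⟨_, ⟨t, V, hV, oV, rfl⟩, hm, hs⟩ :=
    isTopologicalBasis_germSet.exists_subset_of_mem_open hθ hW
  obtain ⟨hθV, e, he, hst⟩ := germ_mem_germSet.1 hm
  refine ⟨V ∩ D e ∩ D (dom s), fun η h => h.2,
    (oV.inter (isClopen_D e).isOpen).inter (isClopen_D _).isOpen, ⟨⟨hθV, he⟩, h⟩, ?_⟩
  rintro _ ⟨η, hη, rfl⟩
  exact hs (germ_mem_germSet.2 ⟨hη.1.1, e, hη.1.2, hst⟩)

theorem continuous_germDom : Continuous (germDom : Germ S → Spectrum S) := by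
  refine ⟨fun W hW => ?_⟩
  rw [isTopologicalBasis_germSet.isOpen_iff]
  intro γ hγ
  obtain ⟨s, θ, h, rfl⟩ := germ_surj γ
  have hU : W ∩ D (dom s) ⊆ D (dom s) := Set.inter_subset_right
  refine ⟨_, ⟨s, _, hU, hW.inter (isClopen_D _).isOpen, rfl⟩,
    germ_mem_germSet_self (hU := hU) ⟨hγ, h⟩, ?_⟩
  rintro _ ⟨η, hη, rfl⟩
  exact hη.1

/-- The map `θ ↦ [s, θ]`. -/
def germSection (s : S) (θ : D (dom s)) : Germ S := germ s θ.1 θ.2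

theorem continuous_germSection (s : S) : Continuous (germSection s) := by
  rw [isTopologicalBasis_germSet.continuous_iff]
  rintro _ ⟨t, U, hU, oU, rfl⟩
  rw [isOpen_iff_mem_nhds]
  rintro ⟨θ, hθ⟩ h
  obtain ⟨h1, e, he, hst⟩ := germ_mem_germSet.1 h
  refine Filter.mem_of_superset
    (((oU.inter (isClopen_D e).isOpen).preimage continuous_subtype_val).mem_nhds ⟨h1, he⟩) ?_
  rintro ⟨η, hη⟩ h'
  exact germ_mem_germSet.2 ⟨h'.1, e, h'.2, hst⟩

theorem isOpenMap_germDom : IsOpenMap (germDom : Germ S → Spectrum S) := by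
  rw [isTopologicalBasis_germSet.isOpenMap_iff]
  rintro _ ⟨s, U, hU, oU, rfl⟩
  convert oU
  ext θ
  constructor
  · rintro ⟨_, ⟨η, hη, rfl⟩, rfl⟩
    exact hη
  · intro h
    exact ⟨_, germ_mem_germSet_self (hU := hU) h, rfl⟩

theorem continuous_beta (s : S) :
    Continuous fun θ : D (dom s) => beta s θ.1 θ.2 := by
  rw [isEmbedding_spectrum_toFun.continuous_iff, continuous_pi_iff]
  intro e
  exact (continuous_spectrum_eval (conj s e)).comp continuous_subtype_val

/-- The set of `θ ∈ D(s* s)` with `β_s(θ) ∈ W`. -/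
def betaPre (s : S) (W : Set (Spectrum S)) : Set (Spectrum S) :=
  {θ | ∃ h : θ (dom s) = true, beta s θ h ∈ W}

theorem isOpen_betaPre (s : S) {W : Set (Spectrum S)} (hW : IsOpen W) :
    IsOpen (betaPre s W) := by
  have : betaPre s W = Subtype.val '' ((fun θ : D (dom s) => beta s θ.1 θ.2) ⁻¹' W) := by
    ext θ
    constructor
    · rintro ⟨h, h'⟩
      exact ⟨⟨θ, h⟩, h', rfl⟩
    · rintro ⟨⟨η, h⟩, h', rfl⟩
      exact ⟨h, h'⟩
  rw [this]
  exact (isClopen_D (dom s)).isOpen.isOpenMap_subtype_val _ (hW.preimage (continuous_beta s))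

theorem continuous_germInv : Continuous (germInv : Germ S → Germ S) := by
  rw [isTopologicalBasis_germSet.continuous_iff]
  rintro _ ⟨t, W, hW, oW, rfl⟩
  rw [isTopologicalBasis_germSet.isOpen_iff]
  intro γ hγ
  obtain ⟨s, θ, h, rfl⟩ := germ_surj γ
  rw [Set.mem_preimage, germInv_germ, germ_mem_germSet] at hγ
  obtain ⟨h1, e, he, hst⟩ := hγ
  have hU : betaPre s (W ∩ D e) ⊆ D (dom s) := fun η h => h.1
  refine ⟨_, ⟨s, _, hU, isOpen_betaPre s (oW.inter (isClopen_D e).isOpen), rfl⟩,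
    germ_mem_germSet_self (hU := hU) ⟨h, h1, he⟩, ?_⟩
  rintro _ ⟨η, ⟨hη, hη1, hη2⟩, rfl⟩
  exact germ_mem_germSet.2 ⟨hη1, e, hη2, hst⟩

theorem germInv_germInv (γ : Germ S) : germInv (germInv γ) = γ := by
  obtain ⟨s, θ, h, rfl⟩ := germ_surj γ
  rw [germInv_germ, germInv_germ]
  refine germ_congr (beta_inv h) _ _ (dom s) ?_ ?_
  · rw [beta_inv h]; exact h
  · rw [inv_inv']

theorem germDom_germInv (γ : Germ S) : germDom (germInv γ) = germRan γ :=
  (universalGroupoid S).d_inv γ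

theorem germRan_eq : (germRan : Germ S → Spectrum S) = germDom ∘ germInv :=
  funext fun γ => (germDom_germInv γ).symm

/-- The inversion of germs as a homeomorphism. -/
def germInvHomeomorph : Germ S ≃ₜ Germ S where
  toFun := germInv
  invFun := germInv
  left_inv := germInv_germInv
  right_inv := germInv_germInv
  continuous_toFun := continuous_germInv
  continuous_invFun := continuous_germInv

theorem continuous_germRan : Continuous (germRan : Germ S → Spectrum S) := by
  rw [germRan_eq]
  exact continuous_germDom.comp continuous_germInv

theorem isOpenMap_germRan : IsOpenMap (germRan : Germ S → Spectrum S) := by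
  rw [germRan_eq]
  exact isOpenMap_germDom.comp germInvHomeomorph.isOpenMap

/-- The product of representatives represents the product of all nearby composable pairs, so
membership in a basic set is witnessed by one idempotent e for all domains in D(e). -/
theorem continuous_germMul : Continuous fun p : {p : Germ S × Germ S // germDom p.1 = germRan p.2} =>
    germMul p.1.1 p.1.2 p.2 := by
  rw [isTopologicalBasis_germSet.continuous_iff]
  rintro _ ⟨x, W, hW, oW, rfl⟩
  rw [isOpen_iff_mem_nhds]
  rintro ⟨⟨γ, δ⟩, hγδ⟩ hm
  obtain ⟨s, η, hs, rfl⟩ := germ_surj γ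
  obtain ⟨t, θ, ht, rfl⟩ := germ_surj δ
  have hη : η = beta t θ ht := hγδ
  subst hη
  have hst := spec_dom_comp ht hs
  rw [Set.mem_preimage, germMul_germ hs ht hγδ hst, germ_mem_germSet] at hm
  obtain ⟨h1, e, he, hx⟩ := hm
  have hU : W ∩ D e ∩ D (dom t) ⊆ D (dom t) := Set.inter_subset_right
  have o1 : IsOpen (germSet s (D (dom s)) subset_rfl) := isOpen_germSet _ (isClopen_D _).isOpen
  have o2 : IsOpen (germSet t _ hU) := isOpen_germSet _
    ((oW.inter (isClopen_D e).isOpen).inter (isClopen_D _).isOpen)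
  refine Filter.mem_of_superset (((o1.prod o2).preimage continuous_subtype_val).mem_nhds
    ⟨germ_mem_germSet_self (hU := subset_rfl) hs,
      germ_mem_germSet_self (hU := hU) ⟨⟨h1, he⟩, ht⟩⟩) ?_
  rintro ⟨⟨γ, δ⟩, hγδ⟩ ⟨⟨η, hη, e1⟩, ⟨ζ, hζ, e2⟩⟩
  simp only at e1 e2
  subst e1 e2
  have h' : η = beta t ζ (hU hζ) := hγδ
  subst h'
  rw [Set.mem_preimage, germMul_germ hη (hU hζ) hγδ (spec_dom_comp (hU hζ) hη), germ_mem_germSet]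
  exact ⟨hζ.1.1, e, hζ.1.2, hx⟩

theorem continuous_germOne : Continuous (germOne : Spectrum S → Germ S) := by
  rw [isTopologicalBasis_germSet.continuous_iff]
  rintro _ ⟨s, W, hW, oW, rfl⟩
  rw [isOpen_iff_mem_nhds]
  intro θ hθ
  obtain ⟨e, he⟩ := exists_idem θ
  rw [Set.mem_preimage, germOne_eq θ e he, germ_mem_germSet] at hθ
  obtain ⟨h1, f, hf, hef⟩ := hθ
  refine Filter.mem_of_superset (((oW.inter (isClopen_D f).isOpen).inter
    (isClopen_D (dom e.1)).isOpen).mem_nhds ⟨⟨h1, hf⟩, he⟩) ?_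
  rintro η ⟨⟨h2, h3⟩, h4 : η (dom e.1) = true⟩
  rw [Set.mem_preimage, germOne_eq η e h4, germ_mem_germSet]
  exact ⟨h2, f, h3, hef⟩

/-- The compact local bisection `(s, D(s* s))`. -/
def bis (s : S) : Set (Germ S) := germSet s (D (dom s)) subset_rfl

theorem mem_bis {s : S} {γ : Germ S} :
    γ ∈ bis s ↔ ∃ h : germDom γ (dom s) = true, γ = germ s (germDom γ) h := by
  constructor
  · rintro ⟨θ, h, rfl⟩
    exact ⟨h, rfl⟩
  · rintro ⟨h, h'⟩
    exact ⟨_, h, h'⟩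

theorem germ_mem_bis {s t : S} {θ : Spectrum S} {h : θ (dom t) = true} :
    germ t θ h ∈ bis s ↔ θ (dom s) = true ∧ ∃ e : Idem S, θ e = true ∧ t * e.1 = s * e.1 :=
  germ_mem_germSet

theorem isOpen_bis (s : S) : IsOpen (bis s) := isOpen_germSet _ (isClopen_D _).isOpen

theorem isCompact_bis (s : S) : IsCompact (bis s) := by
  have : bis s = Set.range (germSection s) := by
    ext γ
    constructor
    · rintro ⟨θ, h, rfl⟩
      exact ⟨⟨θ, h⟩, rfl⟩
    · rintro ⟨⟨θ, h⟩, rfl⟩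
      exact ⟨θ, h, rfl⟩
  have hc : CompactSpace (D (dom s)) := isCompact_iff_compactSpace.1 (isCompact_D _)
  rw [this]
  exact isCompact_range (continuous_germSection s)

theorem injOn_germDom_bis (s : S) : Set.InjOn germDom (bis s) := by
  rintro _ ⟨θ, h, rfl⟩ _ ⟨η, h', rfl⟩ he
  have : θ = η := he
  subst this
  rfl

theorem injOn_germRan_bis (s : S) : Set.InjOn germRan (bis s) := by
  rintro _ ⟨θ, h, rfl⟩ _ ⟨η, h', rfl⟩ he
  have h2 : beta s θ h = beta s η h' := he
  have : θ = η := by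
    rw [← beta_inv h, ← beta_inv h']
    congr 1
  subst this
  rfl

/-- Open sets of arrows on which `d` and `r` are injective are local bisections. -/
theorem isLocalBisection_iff {U : Set (Germ S)} :
    (universalGroupoid S).IsLocalBisection U ↔
      IsOpen U ∧ Set.InjOn germDom U ∧ Set.InjOn germRan U := by
  constructor
  · rintro ⟨h1, h2, h3⟩
    exact ⟨h1, Set.injOn_iff_injective.2 h2.injective, Set.injOn_iff_injective.2 h3.injective⟩
  · rintro ⟨h1, h2, h3⟩
    exact ⟨h1, (IsOpenEmbedding.of_continuous_injective_isOpenMap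
        (continuous_germDom.comp continuous_subtype_val) (Set.injOn_iff_injective.1 h2)
        (isOpenMap_germDom.comp h1.isOpenMap_subtype_val)).isEmbedding,
      (IsOpenEmbedding.of_continuous_injective_isOpenMap
        (continuous_germRan.comp continuous_subtype_val) (Set.injOn_iff_injective.1 h3)
        (isOpenMap_germRan.comp h1.isOpenMap_subtype_val)).isEmbedding⟩

theorem isLocalBisection_bis (s : S) : (universalGroupoid S).IsLocalBisection (bis s) :=
  isLocalBisection_iff.2 ⟨isOpen_bis s, injOn_germDom_bis s, injOn_germRan_bis s⟩

variable (S) in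
theorem universalGroupoid_isAmple : (universalGroupoid S).IsAmple where
  continuous_d := continuous_germDom
  continuous_r := continuous_germRan
  continuous_inv := continuous_germInv
  continuous_mul := continuous_germMul
  isEmbedding_one := IsEmbedding.of_leftInverse (f := germDom)
    (universalGroupoid S).d_one continuous_germDom continuous_germOne
  isLocalHomeomorph_d := by
    rw [isLocalHomeomorph_iff_isOpenEmbedding_restrict]
    intro γ
    obtain ⟨s, θ, h, rfl⟩ := germ_surj γ
    refine ⟨bis s, (isOpen_bis s).mem_nhds ⟨θ, h, rfl⟩, ?_⟩
    exact IsOpenEmbedding.of_continuous_injective_isOpenMap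
        (continuous_germDom.comp continuous_subtype_val)
        (Set.injOn_iff_injective.1 (injOn_germDom_bis s))
        (isOpenMap_germDom.comp (isOpen_bis s).isOpenMap_subtype_val)
  locallyCompact := inferInstance
  hausdorff := inferInstance
  basis := isTopologicalBasis_compact_open

end UniversalTopology

/-! ### Cancellation in groupoids, and convolution with characteristic functions. -/

namespace ArrowGroupoid

section Cancel

variable {X : Type u} {Γ : Type v} (𝒢 : ArrowGroupoid X Γ)

/-- The composability proof depends on the factors; this allows one to replace them nevertheless. -/
theorem mul_congr {α α' β β' : Γ} (h : 𝒢.d α = 𝒢.r β) (e1 : α = α') (e2 : β = β') :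
    𝒢.mul α β h = 𝒢.mul α' β' (by rw [← e1, ← e2, h]) := by
  subst e1 e2
  rfl

theorem inv_mul_cancel_left (α β : Γ) (h : 𝒢.d α = 𝒢.r β)
    (h' : 𝒢.d (𝒢.inv α) = 𝒢.r (𝒢.mul α β h)) : 𝒢.mul (𝒢.inv α) (𝒢.mul α β h) h' = β := by
  have h1 := 𝒢.d_inv α
  have e := 𝒢.inv_mul α h1
  rw [h] at e
  rw [← 𝒢.mul_assoc (𝒢.inv α) α β h1 h (by rw [𝒢.d_mul, h]) h', 𝒢.mul_congr _ e rfl,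
    𝒢.one_mul]

theorem mul_inv_cancel_left (α γ : Γ) (h : 𝒢.d (𝒢.inv α) = 𝒢.r γ)
    (h' : 𝒢.d α = 𝒢.r (𝒢.mul (𝒢.inv α) γ h)) : 𝒢.mul α (𝒢.mul (𝒢.inv α) γ h) h' = γ := by
  have h1 := (𝒢.r_inv α).symm
  have e := 𝒢.mul_inv α h1
  rw [← 𝒢.d_inv, h] at e
  rw [← 𝒢.mul_assoc α (𝒢.inv α) γ h1 h (by rw [𝒢.d_mul, h]) h', 𝒢.mul_congr _ e rfl,
    𝒢.one_mul]

theorem mul_inv_cancel_right (α β : Γ) (h : 𝒢.d α = 𝒢.r β)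
    (h' : 𝒢.d (𝒢.mul α β h) = 𝒢.r (𝒢.inv β)) : 𝒢.mul (𝒢.mul α β h) (𝒢.inv β) h' = α := by
  have h1 := (𝒢.r_inv β).symm
  have e := 𝒢.mul_inv β h1
  rw [← h] at e
  rw [𝒢.mul_assoc α β (𝒢.inv β) h h1 h' (by rw [𝒢.r_mul, h]), 𝒢.mul_congr _ rfl e,
    𝒢.mul_one]

theorem inv_mul_cancel_right (γ β : Γ) (h : 𝒢.d γ = 𝒢.r (𝒢.inv β))
    (h' : 𝒢.d (𝒢.mul γ (𝒢.inv β) h) = 𝒢.r β) : 𝒢.mul (𝒢.mul γ (𝒢.inv β) h) β h' = γ := by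
  have h1 := 𝒢.d_inv β
  have e := 𝒢.inv_mul β h1
  rw [← 𝒢.r_inv, ← h] at e
  rw [𝒢.mul_assoc γ (𝒢.inv β) β h h1 h' (by rw [𝒢.r_mul, h]), 𝒢.mul_congr _ rfl e,
    𝒢.mul_one]

variable {K : Type w} [Field K]

/-- A factorisation γ = α' β with α' in U has r α' = r γ, so injectivity of r on U leaves one term,
with β = α⁻¹ γ. -/
theorem conv_indicator_left {U : Set Γ} (hU : Set.InjOn 𝒢.r U) (c : K) (f : Γ → K) {α γ : Γ}
    (hα : α ∈ U) (h : 𝒢.d (𝒢.inv α) = 𝒢.r γ) :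
    𝒢.conv (U.indicator fun _ => c) f γ = c * f (𝒢.mul (𝒢.inv α) γ h) := by
  have h' : 𝒢.d α = 𝒢.r (𝒢.mul (𝒢.inv α) γ h) := by rw [𝒢.r_mul, 𝒢.r_inv]
  unfold conv
  rw [finsum_eq_single _ ⟨(α, 𝒢.mul (𝒢.inv α) γ h), h', 𝒢.mul_inv_cancel_left _ _ _ _⟩]
  · simp [hα]
  · rintro ⟨⟨α', β⟩, h1, h2⟩ hne
    by_cases hα' : α' ∈ U
    · exfalso
      apply hne
      have : α' = α := hU hα' hα (by
        rw [← 𝒢.d_inv α, h, ← h2, 𝒢.r_mul])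
      subst this
      have : β = 𝒢.mul (𝒢.inv α') γ h := by
        subst h2
        exact (𝒢.inv_mul_cancel_left _ _ _ _).symm
      subst this
      rfl
    · simp [hα']

theorem conv_indicator_right {U : Set Γ} (hU : Set.InjOn 𝒢.d U) (c : K) (f : Γ → K) {β γ : Γ}
    (hβ : β ∈ U) (h : 𝒢.d γ = 𝒢.r (𝒢.inv β)) :
    𝒢.conv f (U.indicator fun _ => c) γ = f (𝒢.mul γ (𝒢.inv β) h) * c := by
  have h' : 𝒢.d (𝒢.mul γ (𝒢.inv β) h) = 𝒢.r β := by rw [𝒢.d_mul, 𝒢.d_inv]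
  unfold conv
  rw [finsum_eq_single _ ⟨(𝒢.mul γ (𝒢.inv β) h, β), h', 𝒢.inv_mul_cancel_right _ _ _ _⟩]
  · simp [hβ]
  · rintro ⟨⟨α, β'⟩, h1, h2⟩ hne
    by_cases hβ' : β' ∈ U
    · exfalso
      apply hne
      have : β' = β := hU hβ' hβ (by
        rw [← 𝒢.r_inv β, ← h, ← h2, 𝒢.d_mul])
      subst this
      have : α = 𝒢.mul γ (𝒢.inv β') h := by
        subst h2
        exact (𝒢.mul_inv_cancel_right _ _ _ _).symm
      subst this
      rfl
    · simp [hβ']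

theorem conv_smul_left (c : K) (f k : Γ → K) : 𝒢.conv (c • f) k = c • 𝒢.conv f k := by
  funext γ
  rw [Pi.smul_apply, conv, conv, smul_finsum]
  exact finsum_congr fun p => _root_.mul_assoc c _ _

theorem conv_smul_right (c : K) (f k : Γ → K) : 𝒢.conv f (c • k) = c • 𝒢.conv f k := by
  funext γ
  rw [Pi.smul_apply, conv, conv, smul_finsum]
  simp only [Pi.smul_apply, smul_eq_mul, mul_left_comm]

theorem conv_zero_left (k : Γ → K) : 𝒢.conv 0 k = 0 := by
  funext γ
  simp [conv]

theorem conv_zero_right (f : Γ → K) : 𝒢.conv f 0 = 0 := by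
  funext γ
  simp [conv]

/-- The set of products of arrows in `U` with arrows in `V`. -/
def setMul (U V : Set Γ) : Set Γ :=
  {γ | ∃ α ∈ U, ∃ β ∈ V, ∃ h : 𝒢.d α = 𝒢.r β, 𝒢.mul α β h = γ}

/-- An arrow has at most one factorisation with left factor in U, since r is injective on U; hence
no multiplicities occur. -/
theorem conv_indicator_indicator {U V : Set Γ} (hU : Set.InjOn 𝒢.r U) :
    𝒢.conv (U.indicator fun _ => (1 : K)) (V.indicator fun _ => 1) =
      (𝒢.setMul U V).indicator fun _ => 1 := by
  funext γ
  by_cases hγ : γ ∈ 𝒢.setMul U V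
  · rw [Set.indicator_of_mem hγ]
    obtain ⟨α, hα, β, hβ, h, rfl⟩ := hγ
    have h' : 𝒢.d (𝒢.inv α) = 𝒢.r (𝒢.mul α β h) := by rw [𝒢.d_inv, 𝒢.r_mul]
    rw [𝒢.conv_indicator_left hU (1 : K) _ hα h', 𝒢.inv_mul_cancel_left,
      Set.indicator_of_mem hβ, _root_.mul_one]
  · rw [Set.indicator_of_notMem hγ, ArrowGroupoid.conv]
    refine finsum_eq_zero_of_forall_eq_zero ?_
    rintro ⟨⟨α, β⟩, h1, h2⟩
    by_cases hα : α ∈ U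
    · by_cases hβ : β ∈ V
      · exact absurd ⟨α, hα, β, hβ, h1, h2⟩ hγ
      · simp [hβ]
    · simp [hα]

end Cancel

/-! ### Finiteness of the convolution sums and additivity of the convolution. -/

section Steinberg

variable {X : Type u} {Γ : Type v} (𝒢 : ArrowGroupoid X Γ)
  [TopologicalSpace X] [TopologicalSpace Γ] {K : Type w} [Field K]

/-- A bisection meets each fibre of r in at most one arrow, and finiteness passes to linear
combinations. -/
theorem finite_support_ran_fibre {f : Γ → K} (hf : f ∈ 𝒢.steinberg K) (x : X) :
    {α | 𝒢.r α = x ∧ f α ≠ 0}.Finite := by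
  induction hf using Submodule.span_induction with
  | mem f h =>
    obtain ⟨U, hU, -, rfl⟩ := h
    apply Set.Subsingleton.finite
    rintro α ⟨h1, h2⟩ β ⟨h3, h4⟩
    exact Set.injOn_iff_injective.2 hU.2.2.injective (Set.mem_of_indicator_ne_zero h2)
      (Set.mem_of_indicator_ne_zero h4) (h1.trans h3.symm)
  | zero => simp
  | add f k _ _ h1 h2 =>
    refine (h1.union h2).subset ?_
    rintro α ⟨h3, h4⟩
    by_cases h5 : f α = 0
    · refine Or.inr ⟨h3, fun h6 => h4 ?_⟩
      simp [h5, h6]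
    · exact Or.inl ⟨h3, h5⟩
  | smul c f _ h =>
    refine h.subset ?_
    rintro α ⟨h3, h4⟩
    exact ⟨h3, fun h5 => h4 (by simp [h5])⟩

/-- By cancellation, a factorisation of γ is determined by its left factor, which lies in the fibre
of r over r γ. This is what makes `finsum` additive below, where it would otherwise take its default
value 0. -/
theorem finite_support_conv {f : Γ → K} (hf : f ∈ 𝒢.steinberg K) (k : Γ → K) (γ : Γ) :
    (Function.support fun p : {p : Γ × Γ // ∃ h : 𝒢.d p.1 = 𝒢.r p.2, 𝒢.mul p.1 p.2 h = γ} =>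
      f p.1.1 * k p.1.2).Finite := by
  refine Set.Finite.of_finite_image (f := fun p => p.1.1)
    ((𝒢.finite_support_ran_fibre hf (𝒢.r γ)).subset ?_) ?_
  · rintro _ ⟨⟨⟨α, β⟩, h1, h2⟩, h3, rfl⟩
    have h2' : 𝒢.mul α β h1 = γ := h2
    refine ⟨by change 𝒢.r α = _; rw [← h2', 𝒢.r_mul], fun h4 => h3 ?_⟩
    simp only at h4
    simp [h4]
  · rintro ⟨⟨α, β⟩, h1, h2⟩ - ⟨⟨α', β'⟩, h1', h2'⟩ - he
    have he' : α = α' := he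
    subst he'
    have : β = β' := by
      rw [← 𝒢.inv_mul_cancel_left α β h1 (by rw [𝒢.d_inv, 𝒢.r_mul]),
        ← 𝒢.inv_mul_cancel_left α β' h1' (by rw [𝒢.d_inv, 𝒢.r_mul])]
      exact 𝒢.mul_congr _ rfl (h2.trans h2'.symm)
    subst this
    rfl

theorem conv_add_left {f f' : Γ → K} (hf : f ∈ 𝒢.steinberg K) (hf' : f' ∈ 𝒢.steinberg K)
    (k : Γ → K) : 𝒢.conv (f + f') k = 𝒢.conv f k + 𝒢.conv f' k := by
  funext γ
  rw [Pi.add_apply]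
  unfold conv
  rw [← finsum_add_distrib (𝒢.finite_support_conv hf k γ) (𝒢.finite_support_conv hf' k γ)]
  simp only [Pi.add_apply, add_mul]

theorem conv_add_right {f : Γ → K} (hf : f ∈ 𝒢.steinberg K)
    (k k' : Γ → K) : 𝒢.conv f (k + k') = 𝒢.conv f k + 𝒢.conv f k' := by
  funext γ
  rw [Pi.add_apply]
  unfold conv
  rw [← finsum_add_distrib (𝒢.finite_support_conv hf k γ) (𝒢.finite_support_conv hf k' γ)]
  simp only [Pi.add_apply, mul_add]

end Steinberg

end ArrowGroupoid

/-! ### The Steinberg algebra of the universal groupoid is closed under convolution. -/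

section UniversalSteinberg

variable {S : Type u} [InverseSemigroupWithZero S] {K : Type w} [Field K]

open InverseSemigroupWithZero

/-- The composable pairs form a closed set since the spectrum is Hausdorff; no separation of the
arrow space is needed. -/
theorem isCompact_germSetMul {U V : Set (Germ S)} (hU : IsCompact U) (hV : IsCompact V) :
    IsCompact ((universalGroupoid S).setMul U V) := by
  have hc : IsCompact (Subtype.val ⁻¹' (U ×ˢ V) :
      Set {p : Germ S × Germ S // germDom p.1 = germRan p.2}) := by
    rw [Subtype.isCompact_iff]
    have e := Subtype.image_preimage_coe {p : Germ S × Germ S | germDom p.1 = germRan p.2}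
      (U ×ˢ V)
    refine (congrArg IsCompact (e.trans (Set.inter_comm _ _))).mpr ?_
    exact (hU.prod hV).inter_right (isClosed_eq (continuous_germDom.comp continuous_fst)
      (continuous_germRan.comp continuous_snd))
  convert hc.image continuous_germMul
  ext γ
  constructor
  · rintro ⟨α, hα, β, hβ, h, rfl⟩
    exact ⟨⟨(α, β), h⟩, ⟨hα, hβ⟩, rfl⟩
  · rintro ⟨⟨⟨α, β⟩, h⟩, ⟨hα, hβ⟩, rfl⟩
    exact ⟨α, hα, β, hβ, h, rfl⟩

theorem isOpen_germSetMul {U V : Set (Germ S)} (oU : IsOpen U) (oV : IsOpen V) :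
    IsOpen ((universalGroupoid S).setMul U V) := by
  rw [isTopologicalBasis_germSet.isOpen_iff]
  rintro _ ⟨α, hα, β, hβ, h, rfl⟩
  obtain ⟨s, η, hs, rfl⟩ := germ_surj α
  obtain ⟨t, θ, ht, rfl⟩ := germ_surj β
  have hη : η = beta t θ ht := h
  subst hη
  obtain ⟨A, hA, oA, hηA, hAU⟩ := exists_germSet_subset oU hα
  obtain ⟨B, hB, oB, hθB, hBV⟩ := exists_germSet_subset oV hβ
  have hC : B ∩ betaPre t A ⊆ D (dom (s * t)) :=
    fun ζ ⟨_, h1, h2⟩ => spec_dom_comp h1 (hA h2)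
  refine ⟨_, ⟨s * t, _, hC, oB.inter (isOpen_betaPre t oA), rfl⟩, ?_, ?_⟩
  · refine (congrArg (· ∈ _) (germMul_germ hs ht h (spec_dom_comp ht hs))).mpr ?_
    exact germ_mem_germSet_self (hU := hC) ⟨hθB, ht, hηA⟩
  · rintro _ ⟨ζ, hζ, rfl⟩
    obtain ⟨hζB, hζt, hζA⟩ := hζ
    exact ⟨_, hAU (germ_mem_germSet_self (hU := hA) hζA), _,
      hBV (germ_mem_germSet_self (hU := hB) hζB), rfl,
      germMul_germ (hA hζA) (hB hζB) rfl (spec_dom_comp hζt (hA hζA))⟩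

theorem isLocalBisection_germSetMul {U V : Set (Germ S)}
    (hU : (universalGroupoid S).IsLocalBisection U)
    (hV : (universalGroupoid S).IsLocalBisection V) :
    (universalGroupoid S).IsLocalBisection ((universalGroupoid S).setMul U V) := by
  rw [isLocalBisection_iff] at hU hV ⊢
  refine ⟨isOpen_germSetMul hU.1 hV.1, ?_, ?_⟩
  · rintro _ ⟨α, hα, β, hβ, h, rfl⟩ _ ⟨α', hα', β', hβ', h', rfl⟩ he
    have e1 : β = β' := hV.2.1 hβ hβ' he
    subst e1
    have e2 : α = α' := hU.2.1 hα hα' (h.trans h'.symm)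
    subst e2
    rfl
  · rintro _ ⟨α, hα, β, hβ, h, rfl⟩ _ ⟨α', hα', β', hβ', h', rfl⟩ he
    have e2 : α = α' := hU.2.2 hα hα' 
      (((universalGroupoid S).r_mul α β h).symm.trans
        (he.trans ((universalGroupoid S).r_mul α' β' h')))
    subst e2
    have e1 : β = β' := hV.2.2 hβ hβ' (h.symm.trans h')
    subst e1
    rfl

theorem indicator_bis_mem_steinberg (s : S) (c : K) :
    (bis s).indicator (fun _ => c) ∈ (universalGroupoid S).steinberg K := by
  have : (bis s).indicator (fun _ => c) = c • (bis s).indicator (fun _ => (1 : K)) := by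
    funext γ
    by_cases h : γ ∈ bis s <;> simp [h]
  rw [this]
  exact Submodule.smul_mem _ _
    (Submodule.subset_span ⟨bis s, isLocalBisection_bis s, isCompact_bis s, rfl⟩)

/-- The Steinberg algebra is closed under convolution. -/
theorem conv_mem_steinberg {f k : Germ S → K} (hf : f ∈ (universalGroupoid S).steinberg K)
    (hk : k ∈ (universalGroupoid S).steinberg K) :
    (universalGroupoid S).conv f k ∈ (universalGroupoid S).steinberg K := by
  induction hf using Submodule.span_induction with
  | mem f hf =>
    have hf' := Submodule.subset_span (R := K) hf
    obtain ⟨U, hU, cU, rfl⟩ := hf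
    induction hk using Submodule.span_induction with
    | mem k hk =>
      obtain ⟨V, hV, cV, rfl⟩ := hk
      rw [ArrowGroupoid.conv_indicator_indicator _ (isLocalBisection_iff.1 hU).2.2]
      exact Submodule.subset_span ⟨_, isLocalBisection_germSetMul hU hV,
        isCompact_germSetMul cU cV, rfl⟩
    | zero =>
      rw [ArrowGroupoid.conv_zero_right]
      exact zero_mem _
    | add k k' _ _ h1 h2 =>
      rw [ArrowGroupoid.conv_add_right _ hf']
      exact add_mem h1 h2
    | smul c k _ h =>
      rw [ArrowGroupoid.conv_smul_right]
      exact Submodule.smul_mem _ _ h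
  | zero =>
    rw [ArrowGroupoid.conv_zero_left]
    exact zero_mem _
  | add f f' hf hf' h1 h2 =>
    rw [ArrowGroupoid.conv_add_left _ hf hf']
    exact add_mem h1 h2
  | smul c f _ h =>
    rw [ArrowGroupoid.conv_smul_left]
    exact Submodule.smul_mem _ _ h

/-- Convolution on the left with a multiple of the characteristic function of `(t, D(t* t))`. -/
theorem conv_bis_left (t s : S) (θ : Spectrum S) (h : θ (dom s) = true) (c : K)
    (f : Germ S → K) (ht : beta s θ h (dom t⁻¹) = true) :
    (universalGroupoid S).conv ((bis t).indicator fun _ => c) f (germ s θ h) =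
      c * f (germ (t⁻¹ * s) θ (spec_dom_comp h ht)) := by
  have hmem : germInv (germ t⁻¹ (beta s θ h) ht) ∈ bis t := by
    rw [germInv_germ, germ_mem_bis]
    have := spec_dom_inv ht
    rw [inv_inv'] at this
    exact ⟨this, dom t, this, by rw [inv_inv']⟩
  have hd : (universalGroupoid S).d ((universalGroupoid S).inv
      (germInv (germ t⁻¹ (beta s θ h) ht))) = (universalGroupoid S).r (germ s θ h) := by
    exact congrArg germDom (germInv_germInv (germ t⁻¹ (beta s θ h) ht))
  refine ((universalGroupoid S).conv_indicator_left (injOn_germRan_bis t) c f hmem hd).trans ?_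
  congr 2
  refine ((universalGroupoid S).mul_congr hd
    (germInv_germInv (germ t⁻¹ (beta s θ h) ht)) rfl).trans ?_
  exact germMul_germ ht h rfl _

/-- Convolution on the right with a multiple of the characteristic function of `(t, D(t* t))`. -/
theorem conv_bis_right (t s : S) (θ : Spectrum S) (h : θ (dom s) = true) (c : K)
    (f : Germ S → K) (ht : θ (dom t) = true)
    (h' : beta t θ ht (dom (s * t⁻¹)) = true) :
    (universalGroupoid S).conv f ((bis t).indicator fun _ => c) (germ s θ h) =
      f (germ (s * t⁻¹) (beta t θ ht) h') * c := by
  have hmem : germ t θ ht ∈ bis t := ⟨θ, ht, rfl⟩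
  have hd : (universalGroupoid S).d (germ s θ h) =
      (universalGroupoid S).r ((universalGroupoid S).inv (germ t θ ht)) := by
    rw [(universalGroupoid S).r_inv]
    rfl
  refine ((universalGroupoid S).conv_indicator_right (injOn_germDom_bis t) c f hmem hd).trans ?_
  congr 2
  exact germMul_germ h (spec_dom_inv ht) hd _

end UniversalSteinberg

namespace SelfSimilarAction

/-! ### Calculation with the elements u g v* and the idempotents w w*. -/

section Words

variable {G : Type u} {X : Type v} [Group G] (σ : SelfSimilarAction G X)

theorem length_actWord (g : G) (w : List X) : (σ.actWord g w).length = w.length := by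
  induction w generalizing g with
  | nil => rfl
  | cons x w ih => simp [actWord, ih]

/-- Together with `prod_append_left` and `prod_eq_zero`, this replaces the recursion by the three
cases of the prefix order. -/
theorem prod_append_right (u : List X) (g : G) (v m : List X) (h : G) (z : List X) :
    σ.prod u g v (v ++ m) h z = Hull.tri (u ++ σ.actWord g m) (σ.secWord g m * h) z := by
  induction v with
  | nil => rfl
  | cons x v ih => simpa [prod] using ih

theorem prod_append_left (u : List X) (g : G) (v m : List X) (h : G) (z : List X) :
    σ.prod u g (v ++ m) v h z =
      Hull.tri u (g * σ.secWord h (σ.actWord h⁻¹ m)) (z ++ σ.actWord h⁻¹ m) := by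
  induction v with
  | nil =>
    cases m with
    | nil => simp [prod, actWord, secWord]
    | cons x m => simp [prod]
  | cons x v ih => simpa [prod] using ih

theorem prod_eq_zero (u : List X) (g : G) (v w : List X) (h : G) (z : List X)
    (h1 : ¬ v <+: w) (h2 : ¬ w <+: v) : σ.prod u g v w h z = Hull.zero := by
  induction v generalizing w with
  | nil => exact absurd List.nil_prefix h1
  | cons x v ih =>
    cases w with
    | nil => exact absurd List.nil_prefix h2
    | cons y w =>
      by_cases hxy : x = y
      · subst hxy
        simp only [List.cons_prefix_cons, true_and] at h1 h2
        simpa [prod] using ih w h1 h2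
      · simp [prod, hxy]

theorem tri_mul_tri_append (u : List X) (g : G) (v m : List X) (h : G) (z : List X) :
    (Hull.tri u g v * Hull.tri (v ++ m) h z : Hull σ) =
      Hull.tri (u ++ σ.actWord g m) (σ.secWord g m * h) z :=
  σ.prod_append_right u g v m h z

theorem tri_append_mul_tri (u : List X) (g : G) (v m : List X) (h : G) (z : List X) :
    (Hull.tri u g (v ++ m) * Hull.tri v h z : Hull σ) =
      Hull.tri u (g * σ.secWord h (σ.actWord h⁻¹ m)) (z ++ σ.actWord h⁻¹ m) :=
  σ.prod_append_left u g v m h z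

theorem tri_mul_tri (u : List X) (g : G) (v : List X) (h : G) (z : List X) :
    (Hull.tri u g v * Hull.tri v h z : Hull σ) = Hull.tri u (g * h) z :=
  σ.prod_self u g v h z

theorem tri_inv (u : List X) (g : G) (v : List X) :
    (Hull.tri u g v : Hull σ)⁻¹ = Hull.tri v g⁻¹ u := rfl

/-- The idempotent `w w*`. -/
def wordIdem (w : List X) : Idem (Hull σ) := ⟨Hull.tri w 1 w, by rw [tri_mul_tri, mul_one]⟩

theorem idem_cases (e : Idem (Hull σ)) : e = 0 ∨ ∃ w, e = σ.wordIdem w := by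
  obtain h | ⟨w, h⟩ := σ.hull_idem e.2
  · exact Or.inl (Subtype.ext h)
  · exact Or.inr ⟨w, Subtype.ext h⟩

theorem dom_tri (u : List X) (g : G) (v : List X) :
    dom (Hull.tri u g v : Hull σ) = σ.wordIdem v := by
  apply Subtype.ext
  change (Hull.tri u g v : Hull σ)⁻¹ * Hull.tri u g v = Hull.tri v 1 v
  rw [tri_inv, tri_mul_tri, inv_mul_cancel]

theorem wordIdem_mul_append (v m : List X) :
    σ.wordIdem v * σ.wordIdem (v ++ m) = σ.wordIdem (v ++ m) := by
  apply Subtype.ext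
  change (Hull.tri v 1 v * Hull.tri (v ++ m) 1 (v ++ m) : Hull σ) = Hull.tri (v ++ m) 1 (v ++ m)
  rw [tri_mul_tri_append, actWord_one, secWord_one, mul_one]

theorem wordIdem_append_mul (v m : List X) :
    σ.wordIdem (v ++ m) * σ.wordIdem v = σ.wordIdem (v ++ m) := by
  apply Subtype.ext
  change (Hull.tri (v ++ m) 1 (v ++ m) * Hull.tri v 1 v : Hull σ) = Hull.tri (v ++ m) 1 (v ++ m)
  rw [tri_append_mul_tri, inv_one, actWord_one, secWord_one, mul_one]

theorem wordIdem_mul_eq_zero {v w : List X} (h1 : ¬ v <+: w) (h2 : ¬ w <+: v) :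
    σ.wordIdem v * σ.wordIdem w = 0 :=
  Subtype.ext (σ.prod_eq_zero _ _ _ _ _ _ h1 h2)

theorem wordIdem_injective : Function.Injective σ.wordIdem := by
  intro v w h
  have := congrArg Subtype.val h
  simp only [wordIdem, Hull.tri.injEq] at this
  exact this.1

variable {σ} in
/-- The word `w` is a prefix of the character `θ`: `θ(w w*) = 1`. -/
def IsPrefix (w : List X) (θ : Spectrum (Hull σ)) : Prop := θ (σ.wordIdem w) = true

theorem apply_dom_tri {u : List X} {g : G} {v : List X} {θ : Spectrum (Hull σ)} :
    θ (dom (Hull.tri u g v)) = true ↔ IsPrefix v θ := by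
  rw [dom_tri]
  rfl

end Words

/-! ### Characters as words, germs, neighbourhoods; minimality and effectiveness. -/

section Characters

variable {G : Type u} {X : Type v} [Group G] {σ : SelfSimilarAction G X}
  {θ η : Spectrum (Hull σ)}

theorem IsPrefix.of_prefix {v w : List X} (h : IsPrefix w θ) (hv : v <+: w) : IsPrefix v θ := by
  obtain ⟨m, rfl⟩ := hv
  exact spec_of_mul_eq θ (σ.wordIdem_append_mul v m) h

theorem IsPrefix.of_append {v m : List X} (h : IsPrefix (v ++ m) θ) : IsPrefix v θ :=
  h.of_prefix (List.prefix_append v m)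

theorem isPrefix_nil (θ : Spectrum (Hull σ)) : IsPrefix [] θ := by
  obtain ⟨e, he⟩ := θ.exists_one
  obtain rfl | ⟨w, rfl⟩ := σ.idem_cases e
  · rw [θ.map_zero] at he
    cases he
  · exact IsPrefix.of_prefix (w := w) he List.nil_prefix

/-- Incomparable words have orthogonal idempotents, and a character sends 0 to 0. -/
theorem IsPrefix.comparable {v w : List X} (hv : IsPrefix v θ) (hw : IsPrefix w θ) :
    v <+: w ∨ w <+: v := by
  by_contra! h
  have := θ.map_mul (σ.wordIdem v) (σ.wordIdem w)
  rw [σ.wordIdem_mul_eq_zero h.1 h.2, θ.map_zero, hv, hw] at this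
  cases this

theorem IsPrefix.prefix_of_length_le {v w : List X} (hv : IsPrefix v θ) (hw : IsPrefix w θ)
    (hl : v.length ≤ w.length) : v <+: w := by
  obtain h | h := hv.comparable hw
  · exact h
  · rw [h.eq_of_length (le_antisymm h.length_le hl)]

/-- Every non-zero idempotent has the form w w*, so the set of prefixes is the whole character. -/
theorem char_ext (h : ∀ w, IsPrefix w θ ↔ IsPrefix w η) : θ = η := by
  apply spectrum_ext
  intro e
  obtain rfl | ⟨w, rfl⟩ := σ.idem_cases e
  · rw [θ.map_zero, η.map_zero]
  · exact Bool.eq_iff_iff.2 (h w)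

variable (σ) in
open Classical in
/-- The character whose prefixes are the words with the property `p`. -/
noncomputable def charOf (p : List X → Prop) (h0 : p []) (h1 : ∀ v m, p (v ++ m) → p v)
    (h2 : ∀ v w, p v → p w → v <+: w ∨ w <+: v) : Spectrum (Hull σ) where
  toFun e := decide (∃ w, e = σ.wordIdem w ∧ p w)
  map_zero := by
    rw [decide_eq_false_iff_not]
    rintro ⟨w, hw, -⟩
    cases congrArg Subtype.val hw
  map_mul e f := by
    rw [← Bool.decide_and, decide_eq_decide]
    obtain rfl | ⟨v, rfl⟩ := σ.idem_cases e
    · have : (0 : Idem (Hull σ)) * f = 0 := Subtype.ext (zero_mul f.1)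
      rw [this]
      constructor
      · rintro ⟨w, hw, -⟩
        cases congrArg Subtype.val hw
      · rintro ⟨⟨w, hw, -⟩, -⟩
        cases congrArg Subtype.val hw
    obtain rfl | ⟨w, rfl⟩ := σ.idem_cases f
    · have : σ.wordIdem v * (0 : Idem (Hull σ)) = 0 := Subtype.ext (mul_zero (σ.wordIdem v).1)
      rw [this]
      constructor
      · rintro ⟨w, hw, -⟩
        cases congrArg Subtype.val hw
      · rintro ⟨-, ⟨w, hw, -⟩⟩
        cases congrArg Subtype.val hw
    have key : ∀ v : List X, (∃ w, σ.wordIdem v = σ.wordIdem w ∧ p w) ↔ p v := fun v =>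
      ⟨fun ⟨w, hw, hp⟩ => σ.wordIdem_injective hw ▸ hp, fun hp => ⟨v, rfl, hp⟩⟩
    rw [propext (key v), propext (key w)]
    -- The product of two word idempotents is that of the longer word if they are comparable, and 0
    -- otherwise.
    by_cases hvw : v <+: w
    · obtain ⟨m, rfl⟩ := hvw
      rw [wordIdem_mul_append, propext (key _)]
      exact ⟨fun h => ⟨h1 _ _ h, h⟩, fun h => h.2⟩
    by_cases hwv : w <+: v
    · obtain ⟨m, rfl⟩ := hwv
      rw [wordIdem_append_mul, propext (key _)]
      exact ⟨fun h => ⟨h, h1 _ _ h⟩, fun h => h.1⟩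
    rw [σ.wordIdem_mul_eq_zero hvw hwv]
    constructor
    · rintro ⟨w, hw, -⟩
      cases congrArg Subtype.val hw
    · rintro ⟨hv, hw⟩
      obtain h | h := h2 v w hv hw
      · exact absurd h hvw
      · exact absurd h hwv
  exists_one := ⟨σ.wordIdem [], decide_eq_true ⟨[], rfl, h0⟩⟩

open Classical in
theorem isPrefix_charOf {p : List X → Prop} {h0 : p []} {h1 : ∀ v m, p (v ++ m) → p v}
    {h2 : ∀ v w, p v → p w → v <+: w ∨ w <+: v} {w : List X} :
    IsPrefix w (charOf σ p h0 h1 h2) ↔ p w := by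
  refine decide_eq_true_iff.trans ⟨fun ⟨v, hv, hp⟩ => σ.wordIdem_injective hv ▸ hp, fun hp => ⟨w, rfl, hp⟩⟩

variable (σ) in
/-- The character of the finite word `w`. -/
noncomputable def wordChar (w : List X) : Spectrum (Hull σ) :=
  charOf σ (fun v => v <+: w) List.nil_prefix
    (fun v m h => (List.prefix_append v m).trans h)
    (fun _ _ hv hw => List.prefix_or_prefix_of_prefix hv hw)

theorem isPrefix_wordChar {v w : List X} : IsPrefix v (wordChar σ w) ↔ v <+: w :=
  isPrefix_charOf

/-- This computes the action on characters: u g v* replaces the prefix v by u and applies g to what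
follows. -/
theorem conj_tri (u : List X) (g : G) (v m : List X) :
    conj (Hull.tri u g v : Hull σ) (σ.wordIdem (u ++ m)) =
      σ.wordIdem (v ++ σ.actWord g⁻¹ m) := by
  apply Subtype.ext
  change (Hull.tri u g v : Hull σ)⁻¹ * Hull.tri (u ++ m) 1 (u ++ m) * Hull.tri u g v =
    Hull.tri (v ++ σ.actWord g⁻¹ m) 1 (v ++ σ.actWord g⁻¹ m)
  have e := σ.secWord_mul g⁻¹ g (σ.actWord g⁻¹ m)
  rw [actWord_act_inv, inv_mul_cancel, secWord_one] at e
  rw [tri_inv, tri_mul_tri_append, tri_append_mul_tri, mul_one, ← e]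

theorem isPrefix_beta_append {u : List X} {g : G} {v m : List X}
    {h : θ (dom (Hull.tri u g v)) = true} :
    IsPrefix (u ++ m) (beta (Hull.tri u g v) θ h) ↔ IsPrefix (v ++ σ.actWord g⁻¹ m) θ := by
  unfold IsPrefix
  rw [beta_apply, conj_tri]

theorem isPrefix_beta {u : List X} {g : G} {v : List X}
    {h : θ (dom (Hull.tri u g v)) = true} : IsPrefix u (beta (Hull.tri u g v) θ h) := by
  have := (isPrefix_beta_append (m := []) (h := h)).2
  simp only [List.append_nil, actWord] at this
  exact this (σ.apply_dom_tri.1 h)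

/-- Germs are not changed by the restriction of a representative to a longer prefix. -/
theorem germ_tri_append (u : List X) (g : G) (v m : List X)
    (h : θ (dom (Hull.tri u g v)) = true)
    (h' : θ (dom (Hull.tri (u ++ σ.actWord g m) (σ.secWord g m) (v ++ m))) = true) :
    germ (Hull.tri u g v) θ h =
      germ (Hull.tri (u ++ σ.actWord g m) (σ.secWord g m) (v ++ m)) θ h' := by
  refine germ_congr rfl h h' (σ.wordIdem (v ++ m)) (σ.apply_dom_tri.1 h') ?_
  change (Hull.tri u g v * Hull.tri (v ++ m) 1 (v ++ m) : Hull σ) =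
    Hull.tri _ _ (v ++ m) * Hull.tri (v ++ m) 1 (v ++ m)
  rw [tri_mul_tri_append, tri_mul_tri]

/-- The idempotent that witnesses equality of germs belongs to a prefix of the character. If it is
longer than v, the rest is m; if it is shorter, the elements already agree and m is empty. -/
theorem germ_tri_eq_iff {u u' : List X} {g g' : G} {v : List X}
    {h : θ (dom (Hull.tri u g v)) = true} {h' : θ (dom (Hull.tri u' g' v)) = true} :
    germ (Hull.tri u g v : Hull σ) θ h = germ (Hull.tri u' g' v) θ h' ↔
      ∃ m, IsPrefix (v ++ m) θ ∧ u ++ σ.actWord g m = u' ++ σ.actWord g' m ∧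
        σ.secWord g m = σ.secWord g' m := by
  constructor
  · intro e
    obtain ⟨-, e, he, hs⟩ := germ_eq_iff.1 e
    obtain rfl | ⟨k, rfl⟩ := σ.idem_cases e
    · rw [θ.map_zero] at he
      cases he
    have hv : IsPrefix v θ := σ.apply_dom_tri.1 h
    change (Hull.tri u g v * Hull.tri k 1 k : Hull σ) = Hull.tri u' g' v * Hull.tri k 1 k at hs
    obtain ⟨m, rfl⟩ | ⟨m, rfl⟩ := hv.comparable (w := k) he
    · rw [tri_mul_tri_append, tri_mul_tri_append, Hull.tri.injEq] at hs
      exact ⟨m, he, hs.1, by simpa using hs.2.1⟩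
    · rw [tri_append_mul_tri, tri_append_mul_tri, Hull.tri.injEq] at hs
      refine ⟨[], by simpa using hv, ?_, ?_⟩
      · simpa [actWord] using hs.1
      · simpa [secWord, secWord_one] using hs.2.1
  · rintro ⟨m, h1, h2, h3⟩
    have a : θ (dom (Hull.tri (u ++ σ.actWord g m) (σ.secWord g m) (v ++ m))) = true :=
      σ.apply_dom_tri.2 h1
    have a' : θ (dom (Hull.tri (u' ++ σ.actWord g' m) (σ.secWord g' m) (v ++ m))) = true :=
      σ.apply_dom_tri.2 h1
    rw [germ_tri_append u g v m h a, germ_tri_append u' g' v m h' a']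
    simp only [h2, h3]

theorem exists_germ_tri (γ : Germ (Hull σ)) : ∃ u g v θ h, γ = germ (Hull.tri u g v) θ h := by
  obtain ⟨s, θ, h, rfl⟩ := germ_surj γ
  cases s with
  | zero =>
    exfalso
    have : dom (Hull.zero : Hull σ) = 0 := rfl
    rw [this, θ.map_zero] at h
    cases h
  | tri u g v => exact ⟨u, g, v, θ, h, rfl⟩

/-! Neighbourhoods. -/

variable (σ) in
/-- The characters that have the prefix `w`, and no prefix `w y` with `y ∈ Y`. -/
def nbhd (w : List X) (Y : Finset X) : Set (Spectrum (Hull σ)) :=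
  {η | IsPrefix w η ∧ ∀ y ∈ Y, ¬ IsPrefix (w ++ [y]) η}

theorem isOpen_nbhd (w : List X) (Y : Finset X) : IsOpen (nbhd σ w Y) := by
  have : nbhd σ w Y = D (σ.wordIdem w) ∩ ⋂ y ∈ Y, (D (σ.wordIdem (w ++ [y])))ᶜ := by
    ext η
    simp only [Set.mem_inter_iff, Set.mem_iInter, Set.mem_compl_iff]
    rfl
  rw [this]
  exact (isClopen_D _).isOpen.inter
    (isOpen_biInter_finset fun y _ => (isClopen_D _).compl.isOpen)

/-- The word of an element `u g v*`. -/
def leftWord : Hull σ → List X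
  | Hull.zero => []
  | Hull.tri u _ _ => u

-- A neighbourhood tests finitely many words. Take for w the longest prefix of θ up to a bound N on
-- their lengths. A tested word that properly extends w continues with a letter y such that `w ++
-- [y]` is not a prefix of θ; these letters are put into Y.
open Classical in
theorem exists_nbhd_subset {V : Set (Spectrum (Hull σ))} (hV : IsOpen V) (hθ : θ ∈ V)
    {v : List X} (hv : IsPrefix v θ) :
    ∃ w Y, v <+: w ∧ θ ∈ nbhd σ w Y ∧ nbhd σ w Y ⊆ V := by
  obtain ⟨E, hE⟩ := exists_finset_of_isOpen hV hθ
  -- The summand `v.length` forces w to extend v.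
  let N := v.length + ∑ e ∈ E, (leftWord e.1).length
  have hN : ∀ u, σ.wordIdem u ∈ E → u.length ≤ N := fun u hu =>
    (Finset.single_le_sum (f := fun e : Idem (Hull σ) => (leftWord e.1).length)
      (fun _ _ => Nat.zero_le _) hu).trans (Nat.le_add_left _ _)
  let p : ℕ → Prop := fun n => ∃ w, IsPrefix w θ ∧ w.length = n
  obtain ⟨w, hw, hwl⟩ : p (Nat.findGreatest p N) :=
    Nat.findGreatest_spec (P := p) (Nat.le_add_right _ _) ⟨v, hv, rfl⟩
  have hmax : ∀ u, IsPrefix u θ → u.length ≤ N → u <+: w := fun u hu hl =>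
    hu.prefix_of_length_le hw (hwl ▸ Nat.le_findGreatest hl ⟨u, hu, rfl⟩)
  refine ⟨w, (E.biUnion fun e => (leftWord e.1).toFinset).filter
      fun y => ¬ IsPrefix (w ++ [y]) θ, hmax v hv (Nat.le_add_right _ _),
    ⟨hw, fun y hy => (Finset.mem_filter.1 hy).2⟩, fun η ⟨hη, hηY⟩ => hE η fun e he => ?_⟩
  obtain rfl | ⟨u, rfl⟩ := σ.idem_cases e
  · rw [θ.map_zero, η.map_zero]
  refine Bool.eq_iff_iff.2 ⟨fun hu => ?_, fun hu => hη.of_prefix (hmax u hu (hN u he))⟩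
  obtain h | ⟨m, rfl⟩ := IsPrefix.comparable (v := u) hu hη
  · exact hw.of_prefix h
  cases m with
  | nil =>
    rw [List.append_nil]
    exact hw
  | cons y m =>
    exfalso
    have hy : IsPrefix (w ++ [y]) η := IsPrefix.of_prefix (w := w ++ y :: m) hu ⟨m, by simp⟩
    have hy' : IsPrefix (w ++ [y]) θ := by
      by_contra hc
      refine hηY y (Finset.mem_filter.2 ⟨Finset.mem_biUnion.2 ⟨_, he, ?_⟩, hc⟩) hy
      simp [leftWord, wordIdem]
    have := (hmax _ hy' (le_trans (by simp) (hN _ he))).length_le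
    simp at this

theorem beta_mem_nbhd {w : List X} {Y : Finset X} {y : X} (hy : y ∉ Y) {g : G}
    {v : List X} {h : θ (dom (Hull.tri (w ++ [y]) g v)) = true} :
    beta (Hull.tri (w ++ [y]) g v) θ h ∈ nbhd σ w Y := by
  have h1 : IsPrefix (w ++ [y]) (beta (Hull.tri (w ++ [y]) g v) θ h) := isPrefix_beta
  refine ⟨h1.of_append, fun y' hy' h2 => hy ?_⟩
  have := (h1.prefix_of_length_le h2 (by simp)).eq_of_length (by simp)
  simp only [List.append_cancel_left_eq, List.cons.injEq, and_true] at this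
  rwa [this]

/-- An open set contains a set `nbhd σ w Y`. As the alphabet is infinite, there is a letter y
outside Y, and the element `w ++ [y]` of the semigroup carries every character into that set. -/
theorem isMinimal [Infinite X] : (universalGroupoid (Hull σ)).IsMinimal := by
  intro U hU hinv
  refine or_iff_not_imp_left.2 fun hne => ?_
  obtain ⟨θ, hθ⟩ := Set.nonempty_iff_ne_empty.2 hne
  obtain ⟨w, Y, -, -, hY⟩ := exists_nbhd_subset hU hθ (isPrefix_nil θ)
  obtain ⟨y, hy⟩ := Infinite.exists_notMem_finset Y
  rw [Set.eq_univ_iff_forall]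
  intro η
  have h : η (dom (Hull.tri (w ++ [y]) 1 [])) = true :=
    σ.apply_dom_tri.2 (isPrefix_nil η)
  exact (hinv (germ _ η h)).2 (hY (beta_mem_nbhd (h := h) hy))

/-- Every character has the empty prefix, so the empty word gives an identity of the semigroup.
Hence the unit space is a single basic bisection, in particular open. -/
theorem range_germOne : Set.range germOne = bis (Hull.tri [] 1 [] : Hull σ) := by
  ext γ
  have h : ∀ θ : Spectrum (Hull σ), θ (dom (σ.wordIdem []).1) = true := fun θ =>
    σ.apply_dom_tri.2 (isPrefix_nil θ)
  constructor
  · rintro ⟨θ, rfl⟩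
    rw [germOne_eq θ (σ.wordIdem []) (h θ)]
    exact ⟨θ, h θ, rfl⟩
  · rintro ⟨θ, hθ, rfl⟩
    exact ⟨θ, germOne_eq θ (σ.wordIdem []) hθ⟩

theorem germ_tri_one (w : List X) (h : θ (dom (Hull.tri w 1 w)) = true) :
    germ (Hull.tri w 1 w : Hull σ) θ h = germOne θ :=
  (germOne_eq θ (σ.wordIdem w) h).symm

theorem wordChar_mem_nbhd (w : List X) (Y : Finset X) : wordChar σ w ∈ nbhd σ w Y :=
  ⟨isPrefix_wordChar.2 (List.prefix_refl w), fun y _ h => by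
    simpa using (isPrefix_wordChar.1 h).length_le⟩

theorem wordChar_append_mem_nbhd {w : List X} {Y : Finset X} {y : X} (hy : y ∉ Y) :
    wordChar σ (w ++ [y]) ∈ nbhd σ w Y :=
  ⟨isPrefix_wordChar.2 (List.prefix_append w [y]), fun y' hy' h => hy (by
    have := (isPrefix_wordChar.1 h).eq_of_length (by simp)
    simp only [List.append_cancel_left_eq, List.cons.injEq, and_true] at this
    rwa [← this])⟩

/-- An interior isotropy germ is represented by u g w* fixing a whole set `nbhd σ w Y`. The finite
words w and w y, with y a letter outside Y moved by g, are characters in this set, and they force u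
= w and g = 1. -/
theorem isEffective (hmove : ∀ g : G, g ≠ 1 → ∀ Y : Finset X, ∃ y ∉ Y, σ.act g y ≠ y) :
    (universalGroupoid (Hull σ)).IsEffective := by
  apply Set.Subset.antisymm
  · intro γ hγ
    obtain ⟨u, g, v, θ, h, rfl⟩ := exists_germ_tri γ
    obtain ⟨U, hU, oU, hθ, hUI⟩ := exists_germSet_subset isOpen_interior hγ
    obtain ⟨w, Y, ⟨m, rfl⟩, hθw, hY⟩ := exists_nbhd_subset oU hθ (σ.apply_dom_tri.1 h)
    have hfix : ∀ η (hη : η ∈ nbhd σ (v ++ m) Y),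
        beta (Hull.tri (u ++ σ.actWord g m) (σ.secWord g m) (v ++ m)) η
          (σ.apply_dom_tri.2 hη.1) = η := by
      intro η hη
      have h1 := interior_subset (hUI (germ_mem_germSet_self (hU := hU) (hY hη)))
      rw [germ_tri_append u g v m (hU (hY hη)) (σ.apply_dom_tri.2 hη.1)] at h1
      exact h1.symm
    rw [germ_tri_append u g v m h (σ.apply_dom_tri.2 hθw.1)]
    have hθw' := σ.apply_dom_tri (u := u ++ σ.actWord g m) (g := σ.secWord g m).2 hθw.1
    generalize v ++ m = w at *
    generalize u ++ σ.actWord g m = u at *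
    generalize σ.secWord g m = g at *
    -- The image of the finite word w is u, since nothing follows w.
    have huw : u = w := by
      have h1 := hfix _ (wordChar_mem_nbhd w Y)
      have h2 : IsPrefix u (wordChar σ w) := h1 ▸ isPrefix_beta
      obtain ⟨k, rfl⟩ := isPrefix_wordChar.1 h2
      have h3 : IsPrefix (u ++ k) (wordChar σ (u ++ k)) :=
        isPrefix_wordChar.2 (List.prefix_refl _)
      rw [← h1, isPrefix_beta_append, isPrefix_wordChar] at h3
      have := h3.length_le
      simp only [List.length_append, length_actWord] at this
      have : k = [] := List.length_eq_zero_iff.1 (by omega)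
      simp [this]
    subst huw
    have hg : g = 1 := by
      by_contra hg
      obtain ⟨y, hy, hgy⟩ := hmove g hg Y
      have h1 := hfix _ (wordChar_append_mem_nbhd hy)
      have h2 : IsPrefix (u ++ [σ.act g y]) (wordChar σ (u ++ [y])) := by
        rw [← h1, isPrefix_beta_append, isPrefix_wordChar]
        have : σ.actWord g⁻¹ [σ.act g y] = [y] := σ.actWord_inv_act g [y]
        rw [this]
      have := (isPrefix_wordChar.1 h2).eq_of_length (by simp)
      simp only [List.append_cancel_left_eq, List.cons.injEq, and_true] at this
      exact hgy this
    subst hg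
    exact ⟨θ, (germ_tri_one u _).symm⟩
  · refine interior_maximal ?_ ?_
    · rintro _ ⟨θ, rfl⟩
      exact ((universalGroupoid (Hull σ)).d_one θ).trans ((universalGroupoid (Hull σ)).r_one θ).symm
    · exact (congrArg IsOpen (range_germOne (σ := σ))).mpr (isOpen_bis _)

end Characters

/-! ### Coefficients at a fixed word. -/

section WordPart

variable {G : Type u} {X : Type v} (K : Type w) [Field K]

/-- The coefficients of the elements `u g`, for a fixed word `u`. -/
noncomputable def wordPart (u : List X) : (List X × G →₀ K) →ₗ[K] (G →₀ K) :=
  Finsupp.lcomapDomain (Prod.mk u) (Prod.mk_right_injective u)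

variable {K}

theorem wordPart_single_self (u : List X) (g : G) (k : K) :
    wordPart K u (Finsupp.single (u, g) k) = Finsupp.single g k := by
  classical
  ext h
  simp [wordPart, Finsupp.lcomapDomain, Finsupp.single_apply]

theorem wordPart_single_of_ne {u u' : List X} (hu : u' ≠ u) (g : G) (k : K) :
    wordPart K u (Finsupp.single (u', g) k) = 0 := by
  classical
  ext h
  simp [wordPart, Finsupp.lcomapDomain, Finsupp.comapDomain_apply, hu]

end WordPart

/-! ### Compression of ideals to the group algebra: a criterion for simplicity. -/

section Simplicity

variable {G : Type u} {X : Type v} [Group G] (σ : SelfSimilarAction G X) (K : Type w) [Field K]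

/-- The linear combinations of the characteristic functions of the bisections of `u g w*`,
for a fixed word `w`. -/
noncomputable def localSum (w : List X) : (List X × G →₀ K) →ₗ[K] (Germ (Hull σ) → K) :=
  Finsupp.linearCombination K fun p => (bis (Hull.tri p.1 p.2 w)).indicator fun _ => 1

/-- The linear combinations of the characteristic functions of the bisections of `g ∈ G`. -/
noncomputable def groupSum : (G →₀ K) →ₗ[K] (Germ (Hull σ) → K) :=
  Finsupp.linearCombination K fun g => (bis (Hull.tri [] g [])).indicator fun _ => 1

open Classical in
/-- The linear map `K G → K G` induced by `g ↦ y'* g y`. -/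
noncomputable def reduce (y y' : X) : (G →₀ K) →ₗ[K] (G →₀ K) :=
  Finsupp.linearCombination K fun g =>
    if σ.act g y = y' then Finsupp.single (σ.sec g y) 1 else 0

variable {σ K}

theorem groupSum_eq_localSum (a : G →₀ K) :
    groupSum σ K a = localSum σ K [] (a.mapDomain (Prod.mk [])) := by
  rw [localSum, Finsupp.linearCombination_mapDomain]
  rfl

theorem mem_bis_tri_append {u : List X} {g : G} {w m : List X} {γ : Germ (Hull σ)}
    (h : IsPrefix (w ++ m) (germDom γ)) :
    γ ∈ bis (Hull.tri u g w) ↔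
      γ ∈ bis (Hull.tri (u ++ σ.actWord g m) (σ.secWord g m) (w ++ m)) := by
  have h1 : germDom γ (dom (Hull.tri u g w)) = true := σ.apply_dom_tri.2 h.of_append
  have h2 : germDom γ (dom (Hull.tri (u ++ σ.actWord g m) (σ.secWord g m) (w ++ m))) = true :=
    σ.apply_dom_tri.2 h
  rw [mem_bis, mem_bis, exists_prop_of_true h1, exists_prop_of_true h2,
    germ_tri_append u g w m h1 h2]

/-- Restriction to a longer prefix changes representatives but not germs; it serves to bring two
local descriptions to a common word. -/
theorem localSum_append {w m : List X} {γ : Germ (Hull σ)} (h : IsPrefix (w ++ m) (germDom γ))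
    (c : List X × G →₀ K) :
    localSum σ K w c γ = localSum σ K (w ++ m)
      (c.mapDomain fun p => (p.1 ++ σ.actWord p.2 m, σ.secWord p.2 m)) γ := by
  rw [localSum, localSum, Finsupp.linearCombination_mapDomain, Finsupp.linearCombination_apply,
    Finsupp.linearCombination_apply, Finsupp.sum, Finsupp.sum, Finset.sum_apply, Finset.sum_apply]
  refine Finset.sum_congr rfl fun p _ => ?_
  rw [Pi.smul_apply, Pi.smul_apply, Function.comp_apply]
  congr 1
  by_cases hp : γ ∈ bis (Hull.tri p.1 p.2 w)
  · rw [Set.indicator_of_mem hp, Set.indicator_of_mem ((mem_bis_tri_append h).1 hp)]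
  · rw [Set.indicator_of_notMem hp,
      Set.indicator_of_notMem fun hp' => hp ((mem_bis_tri_append h).2 hp')]

/-- Locally, an element of the Steinberg algebra is a linear combination of characteristic
functions of bisections `(u g w*, D(w w*))`. -/
theorem exists_eq_localSum {f : Germ (Hull σ) → K}
    (hf : f ∈ (universalGroupoid (Hull σ)).steinberg K) (θ : Spectrum (Hull σ)) :
    ∃ w Y c, θ ∈ nbhd σ w Y ∧ ∀ γ, germDom γ ∈ nbhd σ w Y → f γ = localSum σ K w c γ := by
  induction hf using Submodule.span_induction with
  | mem f hf =>
    obtain ⟨U, hU, cU, rfl⟩ := hf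
    have hU' := isLocalBisection_iff.1 hU
    by_cases hθ : θ ∈ germDom '' U
    · obtain ⟨γ, hγ, rfl⟩ := hθ
      obtain ⟨u, g, v, θ, h, rfl⟩ := exists_germ_tri γ
      obtain ⟨V, hV, oV, hθV, hVU⟩ := exists_germSet_subset hU'.1 hγ
      obtain ⟨w, Y, ⟨m, rfl⟩, hθw, hwV⟩ := exists_nbhd_subset oV hθV (σ.apply_dom_tri.1 h)
      refine ⟨v ++ m, Y, Finsupp.single (u ++ σ.actWord g m, σ.secWord g m) 1, hθw, ?_⟩
      intro δ hδ
      rw [localSum, Finsupp.linearCombination_single, one_smul]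
      have hmem := hVU (germ_mem_germSet_self (hU := hV) (hwV hδ))
      have key : δ ∈ U ↔ δ ∈ bis (Hull.tri u g v) := by
        constructor
        · intro hδU
          exact mem_bis.2 ⟨hV (hwV hδ), hU'.2.1 hδU hmem rfl⟩
        · intro hδb
          obtain ⟨h1, h2⟩ := mem_bis.1 hδb
          rw [h2]
          exact hmem
      rw [mem_bis_tri_append hδ.1] at key
      by_cases hδU : δ ∈ U
      · rw [Set.indicator_of_mem hδU, Set.indicator_of_mem (key.1 hδU)]
      · rw [Set.indicator_of_notMem hδU, Set.indicator_of_notMem fun h => hδU (key.2 h)]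
    -- The compact set U need not be closed among the arrows, but its image in the Hausdorff
    -- spectrum is, so f vanishes over a neighbourhood of θ.
    · have hcl : IsClosed (germDom '' U) := (cU.image continuous_germDom).isClosed
      obtain ⟨w, Y, -, hθw, hw⟩ :=
        exists_nbhd_subset hcl.isOpen_compl (Set.mem_compl hθ) (isPrefix_nil θ)
      refine ⟨w, Y, 0, hθw, fun γ hγ => ?_⟩
      rw [map_zero, Pi.zero_apply, Set.indicator_of_notMem]
      exact fun h => hw hγ ⟨γ, h, rfl⟩
  | zero =>
    refine ⟨[], ∅, 0, ⟨isPrefix_nil θ, by simp⟩, fun γ _ => ?_⟩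
    rw [map_zero]
  | add f f' _ _ h h' =>
    obtain ⟨w, Y, c, hθ, hc⟩ := h
    obtain ⟨w', Y', c', hθ', hc'⟩ := h'
    -- Two prefixes of θ are comparable; the longer one serves both summands.
    obtain ⟨k, hk, hkw, hkw'⟩ : ∃ k, IsPrefix k θ ∧ w <+: k ∧ w' <+: k := by
      obtain h | h := hθ.1.comparable hθ'.1
      · exact ⟨w', hθ'.1, h, List.prefix_refl _⟩
      · exact ⟨w, hθ.1, List.prefix_refl _, h⟩
    obtain ⟨z, Z, hkz, hθz, hz⟩ :=
      exists_nbhd_subset ((isOpen_nbhd w Y).inter (isOpen_nbhd w' Y')) ⟨hθ, hθ'⟩ hk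
    obtain ⟨m, hm⟩ := hkw.trans hkz
    obtain ⟨m', hm'⟩ := hkw'.trans hkz
    refine ⟨z, Z, c.mapDomain (fun p => (p.1 ++ σ.actWord p.2 m, σ.secWord p.2 m)) +
      c'.mapDomain (fun p => (p.1 ++ σ.actWord p.2 m', σ.secWord p.2 m')), hθz, fun γ hγ => ?_⟩
    rw [Pi.add_apply, map_add, Pi.add_apply, hc γ (hz hγ).1, hc' γ (hz hγ).2]
    congr 1
    · subst hm
      exact localSum_append hγ.1 c
    · subst hm'
      exact localSum_append hγ.1 c'
  | smul k f _ h =>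
    obtain ⟨w, Y, c, hθ, hc⟩ := h
    refine ⟨w, Y, k • c, hθ, fun γ hγ => ?_⟩
    rw [Pi.smul_apply, map_smul, Pi.smul_apply, hc γ hγ]

/-- Compression by U* on the left and W on the right only relabels: its value at the germ of x h z*
is that of f at the germ of (U x) h (W z)*. -/
theorem conv_conv_words (U W : List X) (f : Germ (Hull σ) → K) (x : List X) (h : G)
    (z : List X) (θ : Spectrum (Hull σ)) (hθ : θ (dom (Hull.tri x h z)) = true)
    (hW : θ (dom (Hull.tri W 1 [])) = true)
    (h' : beta (Hull.tri W 1 []) θ hW (dom (Hull.tri (U ++ x) h (W ++ z))) = true) :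
    (universalGroupoid (Hull σ)).conv ((bis (Hull.tri [] 1 U)).indicator fun _ => 1)
      ((universalGroupoid (Hull σ)).conv f ((bis (Hull.tri W 1 [])).indicator fun _ => 1))
      (germ (Hull.tri x h z) θ hθ) =
    f (germ (Hull.tri (U ++ x) h (W ++ z)) (beta (Hull.tri W 1 []) θ hW) h') := by
  have e1 : ((Hull.tri [] 1 U : Hull σ)⁻¹ * Hull.tri x h z) = Hull.tri (U ++ x) h z := by
    have := σ.tri_mul_tri_append U 1 [] x h z
    rw [actWord_one, secWord_one, one_mul] at this
    rw [tri_inv, inv_one]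
    exact this
  have e2 : (Hull.tri (U ++ x) h z * (Hull.tri W 1 [])⁻¹ : Hull σ) =
      Hull.tri (U ++ x) h (W ++ z) := by
    have := σ.tri_append_mul_tri (U ++ x) h [] z 1 W
    rw [inv_one, actWord_one, secWord_one, mul_one] at this
    rw [tri_inv, inv_one]
    exact this
  rw [conv_bis_left _ _ _ _ _ _ (σ.apply_dom_tri.2 (isPrefix_nil _)), one_mul]
  simp only [e1]
  rw [conv_bis_right _ _ _ _ _ _ hW (by rw [e2]; exact h'), mul_one]
  simp only [e2]

theorem germ_mem_bis_tri_iff {x u : List X} {h g : G} {v w m : List X} {θ : Spectrum (Hull σ)}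
    (hθ : θ (dom (Hull.tri x h v)) = true) (hv : v = w ++ m) :
    germ (Hull.tri x h v) θ hθ ∈ bis (Hull.tri u g w) ↔
      ∃ k, IsPrefix (v ++ k) θ ∧ x ++ σ.actWord h k =
        u ++ σ.actWord g m ++ σ.actWord (σ.secWord g m) k ∧
          σ.secWord h k = σ.secWord (σ.secWord g m) k := by
  subst hv
  have hm : IsPrefix (w ++ m) θ := σ.apply_dom_tri.1 hθ
  have h1 : θ (dom (Hull.tri (u ++ σ.actWord g m) (σ.secWord g m) (w ++ m))) = true :=
    σ.apply_dom_tri.2 hm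
  rw [mem_bis_tri_append (γ := germ (Hull.tri x h (w ++ m)) θ hθ) hm, mem_bis,
    ← germ_tri_eq_iff (h := hθ) (h' := h1)]
  exact exists_prop_of_true h1

/-- The hypotheses on u' mean that u' is either u or incomparable with u y'. Hence (u y')* u' g (w
y) vanishes unless u' = u and g(y) = y', and then it is the section of g at y. -/
theorem germ_words_mem_bis_iff {u w : List X} {y y' : X} {x : List X} {h : G} {z : List X}
    {θ : Spectrum (Hull σ)} (hθ : θ (dom (Hull.tri x h z)) = true)
    (hW : θ (dom (Hull.tri (w ++ [y]) 1 [])) = true)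
    (h' : beta (Hull.tri (w ++ [y]) 1 []) θ hW
      (dom (Hull.tri (u ++ [y'] ++ x) h (w ++ [y] ++ z))) = true)
    {u' : List X} {g : G} (hl : u.length ≤ u'.length) (hu' : ¬ u ++ [y'] <+: u') :
    germ (Hull.tri (u ++ [y'] ++ x) h (w ++ [y] ++ z)) (beta (Hull.tri (w ++ [y]) 1 []) θ hW) h' ∈
      bis (Hull.tri u' g w) ↔
    u' = u ∧ σ.act g y = y' ∧
      germ (Hull.tri x h z) θ hθ ∈ bis (Hull.tri [] (σ.sec g y) []) := by
  rw [germ_mem_bis_tri_iff h' (m := [y] ++ z) (by simp),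
    germ_mem_bis_tri_iff hθ (m := z) (List.nil_append z).symm]
  simp only [List.nil_append]
  have hpre : ∀ m, IsPrefix (w ++ [y] ++ z ++ m) (beta (Hull.tri (w ++ [y]) 1 []) θ hW) ↔
      IsPrefix (z ++ m) θ := by
    intro m
    rw [List.append_assoc _ z m, isPrefix_beta_append, inv_one, actWord_one, List.nil_append]
  simp only [hpre]
  -- Comparison of lengths makes u a prefix of u'; a further letter of u' would have to be y', which
  -- `hu'` excludes.
  have hlist : ∀ A B : List X, u ++ [y'] ++ A = u' ++ (σ.act g y :: B) ↔
      u' = u ∧ σ.act g y = y' ∧ A = B := by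
    intro A B
    constructor
    · intro e
      have hp : u <+: u' := List.prefix_of_prefix_length_le (l₃ := u ++ [y'] ++ A)
        ⟨[y'] ++ A, by simp⟩ ⟨_, e.symm⟩ hl
      obtain ⟨r, rfl⟩ := hp
      rw [List.append_assoc, List.append_assoc, List.append_cancel_left_eq] at e
      cases r with
      | nil =>
        simp only [List.cons_append, List.nil_append, List.cons.injEq] at e
        exact ⟨by simp, e.1.symm, e.2⟩
      | cons a r =>
        simp only [List.cons_append, List.nil_append, List.cons.injEq] at e
        exact absurd ⟨r, by simp [e.1]⟩ hu'
    · rintro ⟨rfl, rfl, rfl⟩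
      simp
  have hm : ∀ m, (u ++ [y'] ++ x ++ σ.actWord h m = u' ++ σ.actWord g ([y] ++ z) ++
      σ.actWord (σ.secWord g ([y] ++ z)) m) ↔ u' = u ∧ σ.act g y = y' ∧
      x ++ σ.actWord h m = σ.actWord (σ.sec g y) z ++
        σ.actWord (σ.secWord (σ.sec g y) z) m := by
    intro m
    rw [← hlist]
    simp [actWord, secWord]
  simp only [hm]
  have hs : σ.secWord g ([y] ++ z) = σ.secWord (σ.sec g y) z := rfl
  rw [hs]
  constructor
  · rintro ⟨m, h1, ⟨h2, h3, h4⟩, h5⟩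
    exact ⟨h2, h3, m, h1, h4, h5⟩
  · rintro ⟨h2, h3, m, h1, h4, h5⟩
    exact ⟨m, h1, ⟨h2, h3, h4⟩, h5⟩

/-- As y is not in Y, all characters with prefix w y lie where f is the given local sum. Compression
by u y' and w y then selects the terms with word u and maps their group elements g to y'* g y. -/
theorem conv_conv_eq_groupSum {f : Germ (Hull σ) → K} {w : List X} {Y : Finset X}
    {c : List X × G →₀ K}
    (hf : ∀ γ, germDom γ ∈ nbhd σ w Y → f γ = localSum σ K w c γ) {u : List X} {y y' : X}
    (hy : y ∉ Y) (hl : ∀ p ∈ c.support, u.length ≤ p.1.length)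
    (hy' : ∀ p ∈ c.support, ¬ u ++ [y'] <+: p.1) :
    (universalGroupoid (Hull σ)).conv ((bis (Hull.tri [] 1 (u ++ [y']))).indicator fun _ => 1)
      ((universalGroupoid (Hull σ)).conv f
        ((bis (Hull.tri (w ++ [y]) 1 [])).indicator fun _ => 1)) =
    groupSum σ K (reduce σ K y y'
      (wordPart K u c)) := by
  classical
  funext γ
  obtain ⟨x, h, z, θ, hθ, rfl⟩ := exists_germ_tri γ
  have hW : θ (dom (Hull.tri (w ++ [y]) 1 [])) = true := σ.apply_dom_tri.2 (isPrefix_nil θ)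
  have h' : beta (Hull.tri (w ++ [y]) 1 []) θ hW
      (dom (Hull.tri (u ++ [y'] ++ x) h (w ++ [y] ++ z))) = true := by
    rw [σ.apply_dom_tri, isPrefix_beta_append, inv_one, actWord_one]
    exact σ.apply_dom_tri.1 hθ
  rw [conv_conv_words _ _ _ _ _ _ _ hθ hW h', hf (germ _ _ h') (beta_mem_nbhd (h := hW) hy)]
  -- Evaluation of the right-hand side at the germ, as a linear functional of c, so that both sides
  -- can be compared term by term.
  let L : (List X × G →₀ K) →ₗ[K] K := (LinearMap.proj (germ (Hull.tri x h z) θ hθ)) ∘ₗ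
    groupSum σ K ∘ₗ reduce σ K y y' ∘ₗ
      wordPart K u
  have hL : L c = c.sum fun p k => L (Finsupp.single p k) := by
    conv_lhs => rw [← Finsupp.sum_single c]
    exact map_finsuppSum L _ _
  change _ = L c
  rw [hL, localSum, Finsupp.linearCombination_apply, Finsupp.sum, Finsupp.sum, Finset.sum_apply]
  refine Finset.sum_congr rfl fun p hp => ?_
  obtain ⟨u', g⟩ := p
  have key := germ_words_mem_bis_iff hθ hW h' (g := g) (hl _ hp) (hy' _ hp)
  rw [Pi.smul_apply]
  simp only [L, LinearMap.comp_apply, LinearMap.proj_apply]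
  by_cases hu : u' = u
  · subst hu
    rw [wordPart_single_self, reduce, Finsupp.linearCombination_single]
    by_cases hg : σ.act g y = y'
    · rw [if_pos hg, map_smul, groupSum, Finsupp.linearCombination_single, one_smul,
        Pi.smul_apply]
      congr 1
      by_cases hm : germ (Hull.tri x h z) θ hθ ∈ bis (Hull.tri [] (σ.sec g y) [])
      · rw [Set.indicator_of_mem hm, Set.indicator_of_mem (key.2 ⟨rfl, hg, hm⟩)]
      · rw [Set.indicator_of_notMem hm, Set.indicator_of_notMem fun h => hm (key.1 h).2.2]
    · rw [if_neg hg, smul_zero, map_zero, Pi.zero_apply,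
        Set.indicator_of_notMem fun h => hg (key.1 h).2.1, smul_zero]
  · rw [wordPart_single_of_ne hu, map_zero, map_zero, Pi.zero_apply,
      Set.indicator_of_notMem fun h => hu (key.1 h).1, smul_zero]

/-- Convolution with a multiple of the characteristic function of a group element is invertible. -/
theorem conv_conv_group (f : Germ (Hull σ) → K) (g : G) {k : K} (hk : k ≠ 0) :
    (universalGroupoid (Hull σ)).conv ((universalGroupoid (Hull σ)).conv f
      ((bis (Hull.tri [] g⁻¹ [])).indicator fun _ => k⁻¹))
      ((bis (Hull.tri [] g [])).indicator fun _ => k) = f := by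
  funext γ
  obtain ⟨x, h, z, θ, hθ, rfl⟩ := exists_germ_tri γ
  have hg : ∀ (g : G) (η : Spectrum (Hull σ)), η (dom (Hull.tri [] g [])) = true :=
    fun g η => σ.apply_dom_tri.2 (isPrefix_nil η)
  have e : (Hull.tri x h z * (Hull.tri [] g [])⁻¹ * (Hull.tri [] g⁻¹ [])⁻¹ : Hull σ) =
      Hull.tri x h z := by
    rw [tri_inv, tri_inv, inv_inv, mul_assoc, tri_mul_tri, inv_mul_cancel]
    have := σ.tri_append_mul_tri x h [] z 1 []
    rw [inv_one, actWord_one, secWord_one, mul_one] at this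
    exact this
  have b : beta (Hull.tri [] g⁻¹ []) (beta (Hull.tri [] g []) θ (hg _ _)) (hg _ _) = θ :=
    beta_inv (hg g θ)
  have h1 : beta (Hull.tri [] g []) θ (hg _ _)
      (dom (Hull.tri x h z * (Hull.tri [] g [])⁻¹)) = true :=
    spec_dom_comp (spec_dom_inv (hg g θ)) (by
      have := beta_inv (hg g θ)
      rw [this]
      exact hθ)
  have h2 : beta (Hull.tri [] g⁻¹ []) (beta (Hull.tri [] g []) θ (hg _ _)) (hg _ _)
      (dom (Hull.tri x h z * (Hull.tri [] g [])⁻¹ * (Hull.tri [] g⁻¹ [])⁻¹)) = true := by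
    rw [b, e]
    exact hθ
  rw [conv_bis_right _ _ _ _ _ _ (hg _ _) h1, conv_bis_right _ _ _ _ _ _ (hg _ _) h2, mul_assoc,
    inv_mul_cancel₀ hk, mul_one]
  exact congrArg f (germ_congr b _ _ (σ.wordIdem []) (isPrefix_nil _) (by rw [e]))

theorem indicator_bis_conv_self_ne_zero :
    (universalGroupoid (Hull σ)).conv ((bis (Hull.tri [] 1 [])).indicator fun _ => (1 : K))
      ((bis (Hull.tri [] 1 [])).indicator fun _ => 1) ≠ 0 := by
  intro h0
  have h1 := conv_conv_group (σ := σ) ((bis (Hull.tri [] 1 [])).indicator fun _ => (1 : K)) 1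
    one_ne_zero
  rw [inv_one, inv_one, h0, ArrowGroupoid.conv_zero_left] at h1
  have hθ : wordChar σ [] (dom (Hull.tri [] 1 [])) = true :=
    σ.apply_dom_tri.2 (isPrefix_nil _)
  have h2 := congrFun h1 (germ (Hull.tri [] 1 []) (wordChar σ []) hθ)
  rw [Set.indicator_of_mem ((germ_mem_bis (h := hθ)).2 ⟨hθ, dom _, hθ, rfl⟩)] at h2
  exact zero_ne_one h2

open Classical in
/-- A criterion for the simplicity of the Steinberg algebra, in terms of the maps `K G → K G`
induced by pairs of letters. -/
theorem steinbergIsSimple_of_reduce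
    (H1 : ∀ a : G →₀ K, a ≠ 0 → ∀ N : Finset X, ∃ y ∉ N, ∃ y' ∉ N, reduce σ K y y' a ≠ 0)
    (H2 : ∀ a : G →₀ K, 2 ≤ a.support.card → ∃ y y', reduce σ K y y' a ≠ 0 ∧
      (reduce σ K y y' a).support.card < a.support.card) :
    (universalGroupoid (Hull σ)).SteinbergIsSimple K := by
  refine ⟨⟨_, indicator_bis_mem_steinberg _ _, _, indicator_bis_mem_steinberg _ _,
    indicator_bis_conv_self_ne_zero⟩, fun I hIA hI => or_iff_not_imp_left.2 fun hne => ?_⟩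
  obtain ⟨⟨f, hfI⟩, hf0⟩ := AddSubgroup.ne_bot_iff_exists_ne_zero.1 hne
  replace hf0 : f ≠ 0 := fun h => hf0 (Subtype.ext h)
  have htrans : ∀ (f : Germ (Hull σ) → K), f ∈ I → ∀ s t : Hull σ,
      (universalGroupoid (Hull σ)).conv ((bis s).indicator fun _ => 1)
        ((universalGroupoid (Hull σ)).conv f ((bis t).indicator fun _ => 1)) ∈ I :=
    fun f hf s t => (hI _ (indicator_bis_mem_steinberg s 1) _
      (hI _ (indicator_bis_mem_steinberg t 1) f hf).2).1
  obtain ⟨a, ha0, haI⟩ : ∃ a : G →₀ K, a ≠ 0 ∧ groupSum σ K a ∈ I := by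
    obtain ⟨γ, hγ⟩ := Function.ne_iff.1 hf0
    obtain ⟨w, Y, c, hθ, hc⟩ := exists_eq_localSum (hIA hfI) (germDom γ)
    have hc0 : c.support.Nonempty := by
      rw [Finsupp.support_nonempty_iff]
      rintro rfl
      exact hγ (by rw [hc γ hθ, map_zero])
    -- Minimal length of u ensures that no term has a word shorter than u, as compression by u y'
    -- requires.
    obtain ⟨⟨u, g⟩, hp, hmin⟩ := Finset.exists_min_image c.support (fun p => p.1.length) hc0
    have ha : wordPart K u c ≠ 0 := fun h =>
      Finsupp.mem_support_iff.1 hp (DFunLike.congr_fun h g)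
    -- Letters of Y are avoided for y, so that f is still given by c, and letters occurring in the
    -- words of c for y', so that no such word begins with u y'.
    obtain ⟨y, hy, y', hy', hr⟩ :=
      H1 _ ha (Y ∪ c.support.biUnion fun p => p.1.toFinset)
    rw [Finset.notMem_union] at hy hy'
    refine ⟨_, hr, ?_⟩
    rw [← conv_conv_eq_groupSum hc hy.1 hmin]
    · exact htrans f hfI _ _
    · rintro p hp ⟨r, hr⟩
      refine hy'.2 (Finset.mem_biUnion.2 ⟨p, hp, ?_⟩)
      rw [← hr]
      simp
  obtain ⟨g, k, hk, hgI⟩ : ∃ (g : G) (k : K), k ≠ 0 ∧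
      (bis (Hull.tri [] g [])).indicator (fun _ => k) ∈ I := by
    -- `H2` shrinks the support, without reaching 0, until one group element is left; here all words
    -- are empty.
    induction hn : a.support.card using Nat.strong_induction_on generalizing a with
    | _ n ih =>
      by_cases h2 : 2 ≤ a.support.card
      · obtain ⟨y, y', hr, hlt⟩ := H2 a h2
        refine ih _ (hn ▸ hlt) _ hr ?_ rfl
        have hc : ∀ γ, germDom γ ∈ nbhd σ [] ∅ →
            groupSum σ K a γ = localSum σ K [] (a.mapDomain (Prod.mk [])) γ :=
          fun γ _ => by rw [groupSum_eq_localSum]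
        have hsupp : ∀ p ∈ (a.mapDomain (Prod.mk ([] : List X))).support, p.1 = [] := by
          intro p hp
          obtain ⟨g, -, rfl⟩ := Finset.mem_image.1 (Finsupp.mapDomain_support hp)
          rfl
        have := conv_conv_eq_groupSum hc (u := []) (y := y) (y' := y') (by simp) (by simp) (by
          intro p hp
          simp [hsupp p hp])
        have hcm : wordPart K ([] : List X)
            (a.mapDomain (Prod.mk [])) = a :=
          Finsupp.comapDomain_mapDomain _ (Prod.mk_right_injective []) a
        rw [hcm] at this
        rw [← this]
        exact htrans _ haI _ _
      · have h1 : a.support.card = 1 := by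
          have := Finset.card_pos.2 (Finsupp.support_nonempty_iff.2 ha0)
          omega
        obtain ⟨g, k, hk, rfl⟩ := Finsupp.card_support_eq_one'.1 h1
        refine ⟨g, k, hk, ?_⟩
        rw [groupSum, Finsupp.linearCombination_single] at haI
        convert haI using 1
        funext γ
        by_cases hγ : γ ∈ bis (Hull.tri [] g [] : Hull σ) <;> simp [hγ]
  -- A non-zero multiple of a group element is invertible, so it generates everything.
  refine le_antisymm hIA fun f hf => ?_
  rw [← conv_conv_group f g hk]
  exact (hI _ (conv_mem_steinberg hf (indicator_bis_mem_steinberg _ _)) _ hgI).1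

end Simplicity

end SelfSimilarAction

/-! ### Lines in the affine plane over a prime field. -/

section LineForm

/-- The linear forms `(a, b) ↦ b` and `(a, b) ↦ a + t b` on `C_n × C_n`; for prime `n`, their
kernels are the subgroups of order `n`. -/
def lineForm {n : ℕ} (o : Option (ZMod n)) (d : Multiplicative (ZMod n) × Multiplicative (ZMod n)) :
    ZMod n :=
  o.elim d.2.toAdd fun t => d.1.toAdd + t * d.2.toAdd

variable {n : ℕ} (o : Option (ZMod n)) (d e : Multiplicative (ZMod n) × Multiplicative (ZMod n))

theorem lineForm_one : lineForm o (1 : Multiplicative (ZMod n) × Multiplicative (ZMod n)) = 0 := by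
  cases o <;> simp [lineForm]

theorem lineForm_mul : lineForm o (d * e) = lineForm o d + lineForm o e := by
  cases o with
  | none => simp [lineForm]
  | some t =>
    simp only [lineForm, Option.elim_some, Prod.fst_mul, Prod.snd_mul, toAdd_mul]
    ring

variable {o d e}

theorem prod_multiplicative_ext (h1 : d.1.toAdd = e.1.toAdd) (h2 : d.2.toAdd = e.2.toAdd) :
    d = e :=
  Prod.ext (Multiplicative.toAdd.injective h1) (Multiplicative.toAdd.injective h2)

variable [Fact n.Prime]

/-- Lines of different directions meet in at most one point; for slopes s and t the determinant is s
- t. -/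
theorem eq_of_lineForm_eq {o' : Option (ZMod n)} (ho : o ≠ o') (h : lineForm o d = lineForm o e)
    (h' : lineForm o' d = lineForm o' e) : d = e := by
  have aux : ∀ t : ZMod n, d.2.toAdd = e.2.toAdd →
      lineForm (some t) d = lineForm (some t) e → d = e := by
    intro t h1 h2
    simp only [lineForm, Option.elim_some, h1, add_left_inj] at h2
    exact prod_multiplicative_ext h2 h1
  cases o with
  | none =>
    cases o' with
    | none => exact absurd rfl ho
    | some t => exact aux t h h'
  | some s =>
    cases o' with
    | none => exact aux s h' h
    | some t =>
      have hst : s - t ≠ 0 := sub_ne_zero.2 fun h => ho (congrArg some h)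
      refine aux s (mul_left_cancel₀ hst ?_) h
      simp only [lineForm, Option.elim_some] at h h'
      linear_combination h - h'

/-- There is a line through any two points; its direction is found by solving for the slope. -/
theorem exists_lineForm_eq : ∃ o : Option (ZMod n), lineForm o d = lineForm o e := by
  by_cases h : d.2.toAdd = e.2.toAdd
  · exact ⟨none, h⟩
  · refine ⟨some ((e.1.toAdd - d.1.toAdd) / (d.2.toAdd - e.2.toAdd)), ?_⟩
    have h' : d.2.toAdd - e.2.toAdd ≠ 0 := sub_ne_zero.2 h
    simp only [lineForm, Option.elim_some]
    have := div_mul_cancel₀ (e.1.toAdd - d.1.toAdd) h'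
    linear_combination this

open Classical in
/-- Two distinct points are on exactly one line, and one point is on `n + 1` lines. -/
theorem sum_lineForm_eq {K : Type w} [Field K] (k : K) :
    ∑ o : Option (ZMod n), (if lineForm o d = lineForm o e then k else 0) =
      k + if d = e then (n : K) * k else 0 := by
  by_cases h : d = e
  · subst h
    simp only [if_true, Finset.sum_const, Finset.card_univ, Fintype.card_option, ZMod.card,
      nsmul_eq_mul]
    push_cast
    ring
  · obtain ⟨o, ho⟩ := exists_lineForm_eq (d := d) (e := e)
    rw [Finset.sum_eq_single o, if_pos ho, if_neg h, add_zero]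
    · intro o' _ hne
      rw [if_neg fun h' => h (eq_of_lineForm_eq hne h' ho)]
    · simp

end LineForm

/-- The letters: a prime `p ∈ P`, a line form `o` for `p`, an index in `ℕ` and an element of
`ZMod p`. -/
abbrev PrimeLetter (P : Set ℕ) : Type := (p : P) × (Option (ZMod p) × ℕ × ZMod p)

/-- The group element `g` translates the letters at `p` by the values of the line forms at the
`p`-th component of `g`, and its section at these letters is obtained by deletion of
the `p`-th component. -/
def primeAction (P : Set ℕ) : SelfSimilarAction (PrimeProduct P) (PrimeLetter P) where
  act g x := ⟨x.1, x.2.1, x.2.2.1, x.2.2.2 + lineForm x.2.1 (g x.1)⟩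
  sec g x := Function.update g x.1 1
  one_act x := by simp [lineForm_one]
  mul_act g h x := by
    simp only [Pi.mul_apply, lineForm_mul]
    refine congrArg (fun c => (⟨x.1, x.2.1, x.2.2.1, c⟩ : PrimeLetter P)) ?_
    rw [add_comm (lineForm x.2.1 (g x.1)), add_assoc]
  one_sec x := by simp
  mul_sec g h x := by
    rw [← Function.update_mul, one_mul]

/-! ### Compression for the prime action; faithfulness, and simplicity in good characteristic. -/

section PrimeAction

variable {P : Set ℕ} {K : Type w} [Field K]

theorem primeAction_act_eq_iff {g : PrimeProduct P} {p : P} {o : Option (ZMod p)} {n : ℕ}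
    {c : ZMod p} :
    (primeAction P).act g ⟨p, o, n, 0⟩ = ⟨p, o, n, c⟩ ↔ lineForm o (g p) = c := by
  simp [primeAction]

theorem primeAction_act_eq_self {g : PrimeProduct P} {x : PrimeLetter P} :
    (primeAction P).act g x = x ↔ lineForm x.2.1 (g x.1) = 0 := by
  obtain ⟨p, o, n, c⟩ := x
  simp [primeAction]

/-- Elements with a given p-th component are not identified by the sections at letters of p. -/
theorem eq_of_update_one_eq {g h : PrimeProduct P} {p : P} (hp : g p = h p)
    (hu : Function.update g p 1 = Function.update h p 1) : g = h := by
  funext q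
  by_cases hq : q = p
  · rw [hq, hp]
  · have := congrFun hu q
    rwa [Function.update_of_ne hq, Function.update_of_ne hq] at this

open Classical in
theorem reduce_primeAction_apply (p : P) (o : Option (ZMod p)) (n : ℕ) (c : ZMod p)
    (a : PrimeProduct P →₀ K) (h : PrimeProduct P) :
    (primeAction P).reduce K ⟨p, o, n, 0⟩ ⟨p, o, n, c⟩ a h =
      ∑ g ∈ a.support,
        if lineForm o (g p) = c then if Function.update g p 1 = h then a g else 0 else 0 := by
  rw [SelfSimilarAction.reduce, Finsupp.linearCombination_apply, Finsupp.sum, Finsupp.finsetSum_apply]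
  refine Finset.sum_congr rfl fun g _ => ?_
  by_cases h1 : lineForm o (g p) = c
  · rw [if_pos h1, if_pos (primeAction_act_eq_iff.2 h1)]
    simp [Finsupp.single_apply, primeAction]
  · rw [if_neg h1, if_neg fun h' => h1 (primeAction_act_eq_iff.1 h')]
    simp

/-- The coefficients of the compressions are sums of a over lines in cosets of C_p × C_p. If all
vanish, then so does the sum over a coset, as a disjoint union of parallel lines. The sum over the p
+ 1 lines through h exceeds it by p times the coefficient at h, which is therefore zero. -/
theorem exists_reduce_ne_zero (p : P) (hprime : (p : ℕ).Prime) (hK : ((p : ℕ) : K) ≠ 0)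
    {a : PrimeProduct P →₀ K} (ha : a ≠ 0) : ∃ (o : Option (ZMod p)) (c : ZMod p), ∀ n,
      (primeAction P).reduce K ⟨p, o, n, 0⟩ ⟨p, o, n, c⟩ a ≠ 0 := by
  classical
  have : Fact (p : ℕ).Prime := ⟨hprime⟩
  by_contra! hc
  obtain ⟨h, hh⟩ := Finsupp.ne_iff.1 ha
  have hsum : ∀ (o : Option (ZMod p)) (c : ZMod p), ∑ g ∈ a.support,
      (if lineForm o (g p) = c then
        if Function.update g p 1 = Function.update h p 1 then a g else 0 else 0) = 0 := by
    intro o c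
    obtain ⟨n, hn⟩ := hc o c
    rw [← reduce_primeAction_apply p o n, hn, Finsupp.zero_apply]
  -- The total over the coset of h; any one direction would do, and `none` is chosen.
  have h1 : ∑ g ∈ a.support,
      (if Function.update g p 1 = Function.update h p 1 then a g else 0) = 0 := by
    have := Finset.sum_eq_zero fun c (_ : c ∈ Finset.univ) => hsum none c
    rw [Finset.sum_comm] at this
    simpa using this
  -- Now one line through h in every direction.
  have h2 := Finset.sum_eq_zero fun o (_ : o ∈ Finset.univ) => hsum o (lineForm o (h p))
  rw [Finset.sum_comm] at h2
  simp only [sum_lineForm_eq] at h2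
  rw [Finset.sum_add_distrib, h1, zero_add, Finset.sum_eq_single h] at h2
  · simp only [if_true, mul_eq_zero] at h2
    exact h2.elim hK hh
  · intro g _ hg
    by_cases hgp : g p = h p
    · rw [if_neg fun hu => hg (eq_of_update_one_eq hgp hu), mul_zero, ite_self]
    · rw [if_neg hgp]
  · intro hs
    rw [Finsupp.notMem_support_iff.1 hs]
    simp

/-- Terms off the line are killed and the others can only be merged, so one term off the line makes
the support smaller. -/
theorem support_reduce_card_lt (p : P) (o : Option (ZMod p)) (n : ℕ) (c : ZMod p)
    {a : PrimeProduct P →₀ K} {g : PrimeProduct P} (hg : g ∈ a.support)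
    (hc : lineForm o (g p) ≠ c) :
    ((primeAction P).reduce K ⟨p, o, n, 0⟩ ⟨p, o, n, c⟩ a).support.card < a.support.card := by
  classical
  have hsub : ((primeAction P).reduce K ⟨p, o, n, 0⟩ ⟨p, o, n, c⟩ a).support ⊆
      (a.support.filter fun g => lineForm o (g p) = c).image fun g => Function.update g p 1 := by
    intro h hh
    by_contra hn
    refine Finsupp.mem_support_iff.1 hh ?_
    rw [reduce_primeAction_apply]
    refine Finset.sum_eq_zero fun k hk => ?_
    by_cases h1 : lineForm o (k p) = c
    · rw [if_pos h1, if_neg]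
      exact fun h2 => hn (Finset.mem_image.2 ⟨k, Finset.mem_filter.2 ⟨hk, h1⟩, h2⟩)
    · rw [if_neg h1]
  refine ((Finset.card_le_card hsub).trans Finset.card_image_le).trans_lt ?_
  exact Finset.card_lt_card (Finset.filter_ssubset.2 ⟨g, hg, hc⟩)

/-- Take p at which two elements of the support differ, and a line with non-zero compression. If the
support is not contained in this line, the compression is already smaller. Otherwise a line in
another direction meets the support only in elements with one p-th component; these are not merged,
and some element is lost. -/
theorem exists_reduce_card_lt (hprime : ∀ p ∈ P, p.Prime) (hK : ∀ p ∈ P, ((p : ℕ) : K) ≠ 0)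
    (a : PrimeProduct P →₀ K) (ha : 2 ≤ a.support.card) :
    ∃ y y', (primeAction P).reduce K y y' a ≠ 0 ∧
      ((primeAction P).reduce K y y' a).support.card < a.support.card := by
  classical
  obtain ⟨g, hg, h, hh, hgh⟩ := Finset.one_lt_card.1 ha
  obtain ⟨p, hp⟩ := Function.ne_iff.1 hgh
  have : Fact (p : ℕ).Prime := ⟨hprime p p.2⟩
  have ha0 : a ≠ 0 := fun h0 => Finsupp.mem_support_iff.1 hg (by rw [h0, Finsupp.zero_apply])
  obtain ⟨o, c, hoc⟩ := exists_reduce_ne_zero p (hprime p p.2) (hK p p.2) ha0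
  by_cases hall : ∀ k ∈ a.support, lineForm o (k p) = c
  · obtain ⟨o', ho'⟩ := exists_ne o
    have heq : ∀ k ∈ a.support, lineForm o' (k p) = lineForm o' (g p) → k p = g p :=
      fun k hk h' => eq_of_lineForm_eq ho' h' ((hall k hk).trans (hall g hg).symm)
    refine ⟨⟨p, o', 0, 0⟩, ⟨p, o', 0, lineForm o' (g p)⟩, fun h0 => ?_,
      support_reduce_card_lt p o' 0 _ hh fun h' => hp (heq h hh h').symm⟩
    -- The coefficient at the image of g is just that of g.
    have h1 := reduce_primeAction_apply p o' 0 (lineForm o' (g p)) a (Function.update g p 1)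
    rw [h0, Finsupp.zero_apply, Finset.sum_eq_single g, if_pos rfl, if_pos rfl] at h1
    · exact Finsupp.mem_support_iff.1 hg h1.symm
    · intro k hk hkg
      by_cases h2 : lineForm o' (k p) = lineForm o' (g p)
      · rw [if_pos h2, if_neg fun hu => hkg (eq_of_update_one_eq (heq k hk h2) hu)]
      · rw [if_neg h2]
    · exact fun hn => absurd hg hn
  · push Not at hall
    obtain ⟨k, hk, hkc⟩ := hall
    exact ⟨_, _, hoc 0, support_reduce_card_lt p o 0 c hk hkc⟩

/-- This is the purpose of the copies in ℕ: one index avoids the finite set for all primes,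
directions and values at once. -/
theorem exists_index_notMem (N : Finset (PrimeLetter P)) :
    ∃ n : ℕ, ∀ (p : P) (o : Option (ZMod p)) (c : ZMod p), (⟨p, o, n, c⟩ : PrimeLetter P) ∉ N := by
  obtain ⟨n, hn⟩ := Infinite.exists_notMem_finset (N.image fun x => x.2.2.1)
  exact ⟨n, fun p o c h => hn (Finset.mem_image.2 ⟨_, h, rfl⟩)⟩

/-- Forms in two different directions that vanish at a component force it to be trivial. -/
theorem primeAction_moves (hprime : ∀ p ∈ P, p.Prime) (g : PrimeProduct P) (hg : g ≠ 1)
    (Y : Finset (PrimeLetter P)) : ∃ y ∉ Y, (primeAction P).act g y ≠ y := by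
  obtain ⟨p, hp⟩ := Function.ne_iff.1 hg
  have : Fact (p : ℕ).Prime := ⟨hprime p p.2⟩
  obtain ⟨n, hn⟩ := exists_index_notMem Y
  by_contra! hc
  have h : ∀ o : Option (ZMod p), lineForm o (g p) = lineForm o ((1 : PrimeProduct P) p) := by
    intro o
    rw [Pi.one_apply, lineForm_one]
    exact primeAction_act_eq_self.1 (hc ⟨p, o, n, 0⟩ (hn _ _ _))
  exact hp (eq_of_lineForm_eq (Option.some_ne_none 0) (h _) (h _))

theorem primeAction_isFaithful (hprime : ∀ p ∈ P, p.Prime) : (primeAction P).IsFaithful := by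
  intro g hg
  by_contra hne
  obtain ⟨y, -, hy⟩ := primeAction_moves hprime g hne ∅
  have := hg [y]
  simp only [SelfSimilarAction.actWord, List.cons.injEq, and_true] at this
  exact hy this

theorem steinbergIsSimple_primeAction (hne : P.Nonempty) (hprime : ∀ p ∈ P, p.Prime)
    (hK : ∀ p ∈ P, ((p : ℕ) : K) ≠ 0) :
    (universalGroupoid (primeAction P).Hull).SteinbergIsSimple K := by
  refine SelfSimilarAction.steinbergIsSimple_of_reduce (fun a ha N => ?_)
    (exists_reduce_card_lt hprime hK)
  obtain ⟨p, hp⟩ := hne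
  obtain ⟨o, c, hoc⟩ := exists_reduce_ne_zero ⟨p, hp⟩ (hprime p hp) (hK p hp) ha
  obtain ⟨n, hn⟩ := exists_index_notMem N
  exact ⟨_, hn _ _ _, _, hn _ _ _, hoc n⟩

end PrimeAction

/-! ### The action of single components on words. -/

section PrimeActionWords

variable {P : Set ℕ}

theorem map_fst_actWord (g : PrimeProduct P) (w : List (PrimeLetter P)) :
    ((primeAction P).actWord g w).map Sigma.fst = w.map Sigma.fst := by
  induction w generalizing g with
  | nil => rfl
  | cons x w ih => simp [SelfSimilarAction.actWord, primeAction, ← ih ((primeAction P).sec g x)]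

theorem secWord_apply_of_notMem (g : PrimeProduct P) {w : List (PrimeLetter P)} {p : P}
    (hp : p ∉ w.map Sigma.fst) : (primeAction P).secWord g w p = g p := by
  induction w generalizing g with
  | nil => rfl
  | cons x w ih =>
    simp only [List.map_cons, List.mem_cons, not_or] at hp
    rw [SelfSimilarAction.secWord, ih _ hp.2]
    exact Function.update_of_ne hp.1 _ _

theorem act_mulSingle_of_ne {p : P} (d : Multiplicative (ZMod p) × Multiplicative (ZMod p))
    {x : PrimeLetter P} (hx : x.1 ≠ p) :
    (primeAction P).act (Pi.mulSingle p d) x = x ∧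
      (primeAction P).sec (Pi.mulSingle p d) x = Pi.mulSingle p d := by
  have h1 : (Pi.mulSingle p d : PrimeProduct P) x.1 = 1 := Function.update_of_ne hx _ _
  constructor
  · rw [primeAction_act_eq_self, h1, lineForm_one]
  · change Function.update _ _ _ = _
    conv_lhs => rw [← h1, Function.update_eq_self]

theorem sec_mulSingle {p : P} (d : Multiplicative (ZMod p) × Multiplicative (ZMod p))
    {x : PrimeLetter P} (hx : x.1 = p) : (primeAction P).sec (Pi.mulSingle p d) x = 1 := by
  subst hx
  change Function.update _ _ _ = _
  rw [Pi.mulSingle, Function.update_idem, Function.update_eq_self_iff]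
  rfl

theorem actWord_mulSingle_of_notMem {p : P}
    (d : Multiplicative (ZMod p) × Multiplicative (ZMod p)) {w : List (PrimeLetter P)}
    (hp : p ∉ w.map Sigma.fst) : (primeAction P).actWord (Pi.mulSingle p d) w = w := by
  induction w with
  | nil => rfl
  | cons x w ih =>
    simp only [List.map_cons, List.mem_cons, not_or] at hp
    have h := act_mulSingle_of_ne d (Ne.symm hp.1)
    rw [SelfSimilarAction.actWord, h.1, h.2, ih hp.2]

/-- If the prime `p` occurs in the word `w`, then `w` is fixed, with trivial section, by a subgroup
of order `p`. -/
theorem exists_lineForm_actWord {p : P} {w : List (PrimeLetter P)} (hp : p ∈ w.map Sigma.fst) :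
    ∃ o : Option (ZMod p), ∀ d : Multiplicative (ZMod p) × Multiplicative (ZMod p),
      lineForm o d = 0 → (primeAction P).actWord (Pi.mulSingle p d) w = w ∧
        (primeAction P).secWord (Pi.mulSingle p d) w = 1 := by
  induction w with
  | nil => simp at hp
  | cons x w ih =>
    simp only [SelfSimilarAction.actWord, SelfSimilarAction.secWord]
    by_cases hx : x.1 = p
    · subst hx
      refine ⟨x.2.1, fun d hd => ?_⟩
      rw [sec_mulSingle d rfl, SelfSimilarAction.actWord_one, SelfSimilarAction.secWord_one]
      exact ⟨by rw [primeAction_act_eq_self.2 (by rwa [Pi.mulSingle_eq_same])], rfl⟩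
    · simp only [List.map_cons, List.mem_cons, Ne.symm hx, false_or] at hp
      obtain ⟨o, ho⟩ := ih hp
      refine ⟨o, fun d hd => ?_⟩
      have h := act_mulSingle_of_ne d hx
      rw [h.1, h.2, (ho d hd).1]
      exact ⟨rfl, (ho d hd).2⟩

theorem exists_ne_one_lineForm_eq_zero {n : ℕ} [Fact n.Prime] (o : Option (ZMod n)) :
    ∃ d : Multiplicative (ZMod n) × Multiplicative (ZMod n), d ≠ 1 ∧ lineForm o d = 0 := by
  have h1 : Multiplicative.ofAdd (1 : ZMod n) ≠ 1 := fun h =>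
    one_ne_zero (Multiplicative.ofAdd.injective h)
  cases o with
  | none => exact ⟨(Multiplicative.ofAdd 1, 1), fun h => h1 (congrArg Prod.fst h), rfl⟩
  | some t =>
    exact ⟨(Multiplicative.ofAdd (-t), Multiplicative.ofAdd 1),
      fun h => h1 (congrArg Prod.snd h), by simp [lineForm]⟩

/-- A letter at p sees only the p-th component, and sections leave the other components untouched,
so the components act independently. -/
theorem actWord_eq_self_of_forall_mulSingle {g : PrimeProduct P} {w : List (PrimeLetter P)}
    (h : ∀ p, (primeAction P).actWord (Pi.mulSingle p (g p)) w = w) :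
    (primeAction P).actWord g w = w := by
  induction w generalizing g with
  | nil => rfl
  | cons x w ih =>
    simp only [SelfSimilarAction.actWord, List.cons.injEq] at h ⊢
    constructor
    · have := (h x.1).1
      rw [primeAction_act_eq_self, Pi.mulSingle_eq_same] at this
      exact primeAction_act_eq_self.2 this
    · refine ih fun p => ?_
      by_cases hp : x.1 = p
      · have : (primeAction P).sec g x p = 1 := by
          subst hp
          exact Function.update_self _ _ _
        rw [this, Pi.mulSingle_one, SelfSimilarAction.actWord_one]
      · have h1 : (primeAction P).sec g x p = g p := Function.update_of_ne (Ne.symm hp) _ _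
        have h2 := (h p).2
        rwa [(act_mulSingle_of_ne (g p) hp).2, ← h1] at h2

end PrimeActionWords

/-! ### The isotropy groups are uncountable. -/

section Isotropy

open SelfSimilarAction

theorem SelfSimilarAction.beta_group_eq_self {G : Type u} {X : Type v} [Group G]
    {σ : SelfSimilarAction G X} {g : G} {θ : Spectrum (Hull σ)}
    (hg : ∀ w, IsPrefix w θ → σ.actWord g w = w) (h : θ (dom (Hull.tri [] g [])) = true) :
    beta (Hull.tri [] g []) θ h = θ := by
  apply char_ext
  intro w
  have h1 := isPrefix_beta_append (m := w) (h := h)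
  rw [List.nil_append, List.nil_append] at h1
  rw [h1]
  constructor
  · intro hw
    have := hg _ hw
    rw [actWord_act_inv] at this
    rwa [← this] at hw
  · intro hw
    rwa [← hg w hw, actWord_inv_act]

variable {P : Set ℕ}

/-- If p occurs in a prefix of θ, an element of the kernel of the form at its first occurrence fixes
that prefix with trivial section, hence all longer ones. If p never occurs, every element of C_p ×
C_p will do. -/
theorem exists_mulSingle_fixing (hprime : ∀ p ∈ P, p.Prime)
    (θ : Spectrum (primeAction P).Hull) (p : P) :
    ∃ d : Multiplicative (ZMod p) × Multiplicative (ZMod p), d ≠ 1 ∧ ∀ w, IsPrefix w θ →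
      (primeAction P).actWord (Pi.mulSingle p d) w = w := by
  have : Fact (p : ℕ).Prime := ⟨hprime p p.2⟩
  by_cases h : ∃ w, IsPrefix w θ ∧ p ∈ w.map Sigma.fst
  · obtain ⟨w, hw, hpw⟩ := h
    obtain ⟨o, ho⟩ := exists_lineForm_actWord hpw
    obtain ⟨d, hd1, hd⟩ := exists_ne_one_lineForm_eq_zero o
    refine ⟨d, hd1, fun v hv => ?_⟩
    obtain ⟨m, rfl⟩ | ⟨m, rfl⟩ := hv.comparable hw
    · have := (ho d hd).1
      rw [actWord_append] at this
      exact List.append_inj_left this (length_actWord _ _ _)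
    · rw [actWord_append, (ho d hd).1, (ho d hd).2, actWord_one]
  · push Not at h
    obtain ⟨d, hd1, -⟩ := exists_ne_one_lineForm_eq_zero (none : Option (ZMod p))
    exact ⟨d, hd1, fun w hw => actWord_mulSingle_of_notMem d (h w hw)⟩

-- Subsets of P yield isotropy germs, and subsets with equal germs differ by a finite set. There are
-- countably many finite subsets of P, so countably many germs would make the power set of P
-- countable.
open Classical in
theorem isotropyAt_not_countable (hP : P.Infinite) (hprime : ∀ p ∈ P, p.Prime)
    (θ : Spectrum (primeAction P).Hull) :
    ¬ ((universalGroupoid (primeAction P).Hull).isotropyAt θ).Countable := by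
  intro hc
  choose d hd1 hd using exists_mulSingle_fixing hprime θ
  let F : Set P → PrimeProduct P := fun s p => if p ∈ s then d p else 1
  have hF : ∀ s w, IsPrefix w θ → (primeAction P).actWord (F s) w = w := by
    intro s w hw
    refine actWord_eq_self_of_forall_mulSingle fun p => ?_
    by_cases hp : p ∈ s
    · simp only [F, if_pos hp]
      exact hd p w hw
    · simp only [F, if_neg hp, Pi.mulSingle_one, actWord_one]
  have hdom : ∀ g : PrimeProduct P, θ (dom (Hull.tri [] g [])) = true := fun g =>
    (primeAction P).apply_dom_tri.2 (isPrefix_nil θ)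
  let Φ : Set P → (universalGroupoid (primeAction P).Hull).isotropyAt θ := fun s =>
    ⟨germ (Hull.tri [] (F s) []) θ (hdom _), rfl, beta_group_eq_self (hF s) (hdom _)⟩
  -- Equal germs have equal sections at some word m, and the section retains every component whose
  -- prime does not occur in m.
  have hfin : ∀ s t, Φ s = Φ t → (symmDiff s t).Finite := by
    intro s t hst
    obtain ⟨m, -, -, hm⟩ := germ_tri_eq_iff.1 (congrArg Subtype.val hst)
    refine (m.map Sigma.fst).toFinset.finite_toSet.subset fun p hp => ?_
    by_contra hpm
    have hpm' : p ∉ m.map Sigma.fst := fun h => hpm (by simpa using h)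
    have h1 := congrFun hm p
    rw [secWord_apply_of_notMem _ hpm', secWord_apply_of_notMem _ hpm'] at h1
    obtain ⟨h2, h3⟩ | ⟨h2, h3⟩ := hp
    · simp only [F, if_pos h2, if_neg h3] at h1
      exact hd1 p h1
    · simp only [F, if_pos h2, if_neg h3] at h1
      exact hd1 p h1.symm
  have : Countable ((universalGroupoid (primeAction P).Hull).isotropyAt θ) := hc.to_subtype
  -- The power set is the union of the fibres of Φ, each of which consists of finite modifications
  -- of one set.
  have hcount : (Set.univ : Set (Set P)).Countable := by
    have : (Set.univ : Set (Set P)) = ⋃ y, Φ ⁻¹' {y} := by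
      rw [← Set.preimage_iUnion, Set.iUnion_of_singleton, Set.preimage_univ]
    rw [this]
    refine Set.countable_iUnion fun y => ?_
    obtain h | ⟨s, hs⟩ := (Φ ⁻¹' {y}).eq_empty_or_nonempty
    · rw [h]
      exact Set.countable_empty
    · refine ((Set.Countable.ofPred_finite (α := P)).image (symmDiff s)).mono ?_
      intro t ht
      exact ⟨symmDiff s t, hfin s t (Eq.trans hs (Eq.symm ht)), symmDiff_symmDiff_cancel_left s t⟩
  have : Countable (Set P) := Set.countable_univ_iff.1 hcount
  have : Infinite P := hP.to_subtype
  obtain ⟨f, hf⟩ := exists_injective_nat (Set P)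
  exact Function.cantor_injective (fun s => Infinite.natEmbedding P (f s))
    ((Infinite.natEmbedding P).injective.comp hf)

theorem not_isTopologicallyPrincipal (hP : P.Infinite) (hprime : ∀ p ∈ P, p.Prime) :
    ¬ (universalGroupoid (primeAction P).Hull).IsTopologicallyPrincipal := by
  intro h
  obtain ⟨θ, hθ⟩ := h.nonempty_iff.2 ⟨wordChar (primeAction P) []⟩
  refine isotropyAt_not_countable hP hprime θ ?_
  rw [show (universalGroupoid (primeAction P).Hull).isotropyAt θ = _ from hθ]
  exact Set.countable_singleton _

end Isotropy

/-! ### A proper non-zero ideal in characteristic p. -/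

section NotSimple

open SelfSimilarAction

variable {P : Set ℕ} {K : Type w} [Field K]

/-- The characters in which the prime `p` occurs infinitely often. -/
def recurrentChars (p : P) : Set (Spectrum (primeAction P).Hull) :=
  {θ | ∀ v, IsPrefix v θ → ∃ m, IsPrefix (v ++ m) θ ∧ p ∈ m.map Sigma.fst}

/-- The group changes letters but not their primes, and exchanging a finite prefix does not affect
infinite recurrence. A single occurrence would not be invariant, because the prefix that contains it
can be removed. -/
theorem beta_mem_recurrentChars {p : P} {θ : Spectrum (primeAction P).Hull}
    (hθ : θ ∈ recurrentChars p) {s : (primeAction P).Hull} (h : θ (dom s) = true) :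
    beta s θ h ∈ recurrentChars p := by
  cases s with
  | zero =>
    have e : dom (Hull.zero : (primeAction P).Hull) = 0 := rfl
    rw [e, θ.map_zero] at h
    cases h
  | tri u g v =>
    have key : ∀ k, IsPrefix (u ++ k) (beta (Hull.tri u g v) θ h) →
        ∃ m, IsPrefix (u ++ k ++ m) (beta (Hull.tri u g v) θ h) ∧ p ∈ m.map Sigma.fst := by
      intro k hk
      obtain ⟨m, hm, hpm⟩ := hθ _ (isPrefix_beta_append.1 hk)
      refine ⟨(primeAction P).actWord ((primeAction P).secWord g
        ((primeAction P).actWord g⁻¹ k)) m, ?_, by rwa [map_fst_actWord]⟩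
      have e := (primeAction P).actWord_append g ((primeAction P).actWord g⁻¹ k) m
      rw [actWord_act_inv] at e
      rw [List.append_assoc, isPrefix_beta_append, ← e, actWord_inv_act, ← List.append_assoc]
      exact hm
    intro w hw
    obtain ⟨k, rfl⟩ | ⟨k, rfl⟩ := (isPrefix_beta (h := h)).comparable hw
    · exact key k hw
    · obtain ⟨m, hm, hpm⟩ := key [] (by rw [List.append_nil]; exact isPrefix_beta)
      refine ⟨k ++ m, ?_, by simp [hpm]⟩
      rwa [List.append_nil, List.append_assoc] at hm

theorem germRan_mem_recurrentChars {p : P} {γ : Germ (primeAction P).Hull}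
    (h : germDom γ ∈ recurrentChars p) : germRan γ ∈ recurrentChars p := by
  obtain ⟨s, θ, hs, rfl⟩ := germ_surj γ
  exact beta_mem_recurrentChars h hs

/-- The constant infinite word of a letter at p is an example. -/
theorem recurrentChars_nonempty (p : P) : (recurrentChars p).Nonempty := by
  let x : PrimeLetter P := ⟨p, none, 0, 0⟩
  refine ⟨charOf (primeAction P) (fun w => ∀ y ∈ w, y = x) (by simp)
    (fun v m h y hy => h y (List.mem_append_left m hy)) (fun v w hv hw => ?_), fun v hv => ?_⟩
  · rw [List.eq_replicate_of_mem hv, List.eq_replicate_of_mem hw]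
    obtain h | h := le_total v.length w.length
    · exact Or.inl ⟨List.replicate (w.length - v.length) x, by
        rw [← List.replicate_add, Nat.add_sub_cancel' h]⟩
    · exact Or.inr ⟨List.replicate (v.length - w.length) x, by
        rw [← List.replicate_add, Nat.add_sub_cancel' h]⟩
  · rw [isPrefix_charOf] at hv
    refine ⟨[x], isPrefix_charOf.2 fun y hy => ?_, by simp [x]⟩
    obtain h | h := List.mem_append.1 hy
    · exact hv y h
    · simpa using h

/-- F is constant on the cosets of a subgroup of order n, so the sum is a multiple of n. -/
theorem sum_eq_zero_of_lineForm {n : ℕ} [Fact n.Prime] (hn : (n : K) = 0) (o : Option (ZMod n))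
    (F : Multiplicative (ZMod n) × Multiplicative (ZMod n) → K)
    (hF : ∀ d e, lineForm o e = 0 → F (d * e) = F d) : ∑ d, F d = 0 := by
  have hF' : ∀ d d', lineForm o d = lineForm o d' → F d = F d' := by
    intro d d' h
    rw [← hF d' (d'⁻¹ * d), mul_inv_cancel_left]
    have h1 := lineForm_mul o d' (d'⁻¹ * d)
    rw [mul_inv_cancel_left, h] at h1
    simpa using h1
  have hconst : ∀ k : K, ∑ _x : Multiplicative (ZMod n), k = 0 := by
    intro k
    simp [ZMod.card, hn]
  cases o with
  | none =>
    rw [Fintype.sum_prod_type_right]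
    refine Finset.sum_eq_zero fun y _ => ?_
    rw [← hconst (F (1, y))]
    exact Finset.sum_congr rfl fun x _ => hF' _ _ rfl
  | some t =>
    -- All rows have the same sum, since translation along the line carries each row to the row over
    -- the neutral element; there are n rows.
    rw [Fintype.sum_prod_type_right, ← hconst (∑ x, F (x, 1))]
    refine Finset.sum_congr rfl fun y _ => ?_
    refine Fintype.sum_equiv (Equiv.mulRight (Multiplicative.ofAdd (t * y.toAdd))) _ _ fun x => ?_
    exact hF' _ _ (by simp [lineForm])

-- The ideal consists of the functions that vanish at all arrows with domain in `recurrentChars p`.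
-- It is two-sided because this set of characters is invariant, it is proper because the set is
-- non-empty, and it contains the sum over C_p × C_p, which is non-zero at the empty word.
open Classical in
theorem not_steinbergIsSimple (hprime : ∀ p ∈ P, p.Prime) (p : P) (hp : ((p : ℕ) : K) = 0) :
    ¬ (universalGroupoid (primeAction P).Hull).SteinbergIsSimple K := by
  have : Fact (p : ℕ).Prime := ⟨hprime p p.2⟩
  rintro ⟨-, hsimple⟩
  let I : AddSubgroup (Germ (primeAction P).Hull → K) :=
    { carrier := {f | f ∈ (universalGroupoid (primeAction P).Hull).steinberg K ∧
        ∀ γ, germDom γ ∈ recurrentChars p → f γ = 0}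
      zero_mem' := ⟨zero_mem _, fun _ _ => rfl⟩
      add_mem' := fun {f k} hf hk => ⟨add_mem hf.1 hk.1, fun γ hγ => by
        rw [Pi.add_apply, hf.2 γ hγ, hk.2 γ hγ, add_zero]⟩
      neg_mem' := fun {f} hf => ⟨neg_mem hf.1, fun γ hγ => by
        rw [Pi.neg_apply, hf.2 γ hγ, neg_zero]⟩ }
  have hdom : ∀ (g : PrimeProduct P) (θ : Spectrum (primeAction P).Hull),
      θ (dom (Hull.tri [] g [])) = true := fun g θ =>
    (primeAction P).apply_dom_tri.2 (isPrefix_nil θ)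
  have hI : ∀ f ∈ (universalGroupoid (primeAction P).Hull).steinberg K, ∀ k ∈ I,
      (universalGroupoid (primeAction P).Hull).conv f k ∈ I ∧
        (universalGroupoid (primeAction P).Hull).conv k f ∈ I := by
    refine fun f hf k hk => ⟨⟨conv_mem_steinberg hf hk.1, fun γ hγ => ?_⟩,
      ⟨conv_mem_steinberg hk.1 hf, fun γ hγ => ?_⟩⟩
    · refine finsum_eq_zero_of_forall_eq_zero ?_
      rintro ⟨⟨α, β⟩, h1, rfl⟩
      rw [show k β = 0 from hk.2 β hγ, mul_zero]
    · refine finsum_eq_zero_of_forall_eq_zero ?_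
      rintro ⟨⟨α, β⟩, h1, rfl⟩
      have hβ : germDom β ∈ recurrentChars p := hγ
      have hα : germDom α = germRan β := h1
      rw [show k α = 0 from hk.2 α (by rw [hα]; exact germRan_mem_recurrentChars hβ), zero_mul]
  obtain h | h := hsimple I (fun f hf => hf.1) hI
  · let N : Germ (primeAction P).Hull → K :=
      ∑ d : Multiplicative (ZMod p) × Multiplicative (ZMod p),
        (bis (Hull.tri [] (Pi.mulSingle p d) [])).indicator fun _ => 1
    have hNapply : ∀ γ, N γ = ∑ d : Multiplicative (ZMod p) × Multiplicative (ZMod p),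
        (bis (Hull.tri [] (Pi.mulSingle p d) [])).indicator (fun _ => 1) γ :=
      fun γ => Finset.sum_apply _ _ _
    have hN : N ∈ I := by
      refine ⟨sum_mem fun d _ => indicator_bis_mem_steinberg _ _, fun γ hγ => ?_⟩
      obtain ⟨m, hm, hpm⟩ := hγ [] (isPrefix_nil _)
      obtain ⟨o, ho⟩ := exists_lineForm_actWord hpm
      rw [hNapply]
      refine sum_eq_zero_of_lineForm hp o _ fun d e he => ?_
      -- A prefix m that contains p is fixed with trivial section by the kernel of a form, so the
      -- germs of d and d e coincide for e in this kernel.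
      have heq : germ (Hull.tri [] (Pi.mulSingle p (d * e)) []) (germDom γ) (hdom _ _) =
          germ (Hull.tri [] (Pi.mulSingle p d) []) (germDom γ) (hdom _ _) := by
        refine germ_tri_eq_iff.2 ⟨m, hm, ?_, ?_⟩
        · rw [Pi.mulSingle_mul, actWord_mul, (ho e he).1]
        · rw [Pi.mulSingle_mul, secWord_mul, (ho e he).1, (ho e he).2, mul_one]
      have hiff : γ ∈ bis (Hull.tri [] (Pi.mulSingle p (d * e)) []) ↔
          γ ∈ bis (Hull.tri [] (Pi.mulSingle p d) []) := by
        rw [mem_bis, mem_bis, exists_prop_of_true (hdom _ _), exists_prop_of_true (hdom _ _), heq]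
      simp only [Set.indicator_apply, hiff]
    -- At the empty word no component has been tested, so the elements of C_p × C_p have distinct
    -- germs and only d = 1 contributes.
    have hN1 : N (germ (Hull.tri [] 1 []) (wordChar _ []) (hdom _ _)) = 1 := by
      rw [hNapply, Finset.sum_eq_single 1]
      · rw [Pi.mulSingle_one]
        exact Set.indicator_of_mem ((germ_mem_bis (h := hdom _ _)).2
          ⟨hdom _ _, dom _, hdom 1 _, rfl⟩) _
      · intro d _ hd
        refine Set.indicator_of_notMem (fun hm => hd ?_) _
        obtain ⟨k, hk, -, hs⟩ := (germ_mem_bis_tri_iff (hdom _ _) (List.nil_append []).symm).1 hm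
        have hk0 : k = [] := List.prefix_nil.1 (isPrefix_wordChar.1 hk)
        subst hk0
        have := congrFun hs p
        simpa [secWord] using this.symm
      · simp
    rw [h, AddSubgroup.mem_bot] at hN
    rw [hN] at hN1
    exact zero_ne_one hN1
  · obtain ⟨θ, hθ⟩ := recurrentChars_nonempty p
    have h1 : (bis (Hull.tri [] 1 [] : (primeAction P).Hull)).indicator (fun _ => (1 : K)) ∈ I := by
      rw [h]
      exact indicator_bis_mem_steinberg _ _
    have h2 := h1.2 (germ (Hull.tri [] 1 []) θ (hdom _ _)) hθ
    rw [Set.indicator_of_mem ((germ_mem_bis (h := hdom _ _)).2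
      ⟨hdom _ _, dom _, hdom 1 _, rfl⟩)] at h2
    exact one_ne_zero h2

theorem steinbergIsSimple_primeAction_iff (hne : P.Nonempty) (hprime : ∀ p ∈ P, p.Prime) :
    (universalGroupoid (primeAction P).Hull).SteinbergIsSimple K ↔ ringChar K ∉ P := by
  constructor
  · intro h hmem
    exact not_steinbergIsSimple hprime ⟨ringChar K, hmem⟩ (ringChar.Nat.cast_ringChar) h
  · intro h
    refine steinbergIsSimple_primeAction hne hprime fun p hp hp0 => h ?_
    -- If p = 0 in K, the characteristic divides p; being 1 is impossible in a field.
    obtain h1 | h1 := (Nat.dvd_prime (hprime p hp)).1 (ringChar.dvd hp0)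
    · have := ringChar.Nat.cast_ringChar (R := K)
      rw [h1, Nat.cast_one] at this
      exact absurd this one_ne_zero
    · rwa [h1]

end NotSimple

end AmpleGpd

theorem mainTheorem10 (P : Set ℕ) (hP : P.Infinite) (hprime : ∀ p ∈ P, p.Prime) :
    ∃ (X : Type) (_ : Nontrivial X)
      (σ : AmpleGpd.SelfSimilarAction (AmpleGpd.PrimeProduct P) X),
      σ.IsFaithful ∧
      (AmpleGpd.universalGroupoid σ.Hull).IsAmple ∧
      (AmpleGpd.universalGroupoid σ.Hull).IsMinimal ∧
      (AmpleGpd.universalGroupoid σ.Hull).IsEffective ∧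
      (∀ (K : Type*) [Field K],
        (AmpleGpd.universalGroupoid σ.Hull).SteinbergIsSimple K ↔ ringChar K ∉ P) ∧
      (∀ x : AmpleGpd.Spectrum σ.Hull,
        ¬ ((AmpleGpd.universalGroupoid σ.Hull).isotropyAt x).Countable) ∧
      ¬ (AmpleGpd.universalGroupoid σ.Hull).IsTopologicallyPrincipal := by
  have hne : P.Nonempty := hP.nonempty
  have : Nonempty P := hne.to_subtype
  -- Needed for minimality, and it also makes the alphabet non-trivial.
  have : Infinite (AmpleGpd.PrimeLetter P) :=
    Infinite.of_injective
      (fun n : ℕ => (⟨Classical.arbitrary P, none, n, 0⟩ : AmpleGpd.PrimeLetter P))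
      fun m n h => by simpa using h
  exact ⟨AmpleGpd.PrimeLetter P, inferInstance, AmpleGpd.primeAction P,
    AmpleGpd.primeAction_isFaithful hprime, AmpleGpd.universalGroupoid_isAmple _,
    AmpleGpd.SelfSimilarAction.isMinimal,
    AmpleGpd.SelfSimilarAction.isEffective (AmpleGpd.primeAction_moves hprime),
    fun K _ => AmpleGpd.steinbergIsSimple_primeAction_iff hne hprime,
    AmpleGpd.isotropyAt_not_countable hP hprime,
    AmpleGpd.not_isTopologicallyPrincipal hP hprime⟩
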